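/- Consider scheduling on uniformly related machines with activation costs. An instance consists of $n$ jobs with processing requirements $p_j>0$ and $m$ machines with speeds $s_i>0$ and activation costs $a_i\ge 0$, all rational numbers; job $j$ takes time $p_j/s_i$ on machine $i$. A schedule is a set $S$ of machines to be activated together with an assignment of every job to a machine in $S$. Its activation cost is $a(S)=\sum_{i\in S}a_i$, and its makespan is the maximum over the machines $i$ of $\sum_{j \text{ assigned to } i} p_j/s_i$. For every fixed $\varepsilon>0$ the following hold, where running time is polynomial in the length of the input, numbers being written in binary. 1. There is a polynomial-time algorithm that, given an instance and a rational activation budget $A\ge 0$, finds a schedule such that, for every $T$: if a schedule with activation cost at most $A$ and makespan at most $T$ exists, then the schedule found has activation cost at most $A$ and makespan at most $(1+\varepsilon)T$. 2. There is a polynomial-time algorithm that, given an instance and a rational makespan bound $T\ge 0$, finds a schedule such that, for every $A$: if a schedule with activation cost at most $A$ and makespan at most $T$ exists, then the schedule found has activation cost at most $A$ and makespan at most $(1+\varepsilon)T$. (If no schedule satisfies the respective bound given in the input, the algorithm still halts in polynomial time, and nothing is claimed about its output.) -/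

import Mathlib

namespace MachineActivation

/-! ### A programming language with a step count

Data are binary trees whose leaves are natural numbers written in binary. Programs are built from
elementary operations by composition, pairing, case distinction and while loops. Every operation is
charged the number of symbols it reads and writes, so running times agree, up to a polynomial, with
those of multitape Turing machines (and of random access machines under the logarithmic cost
criterion). -/

/-- Data: binary trees with natural numbers at the leaves. -/
inductive Val : Type
  | num (n : ℕ) : Val
  | pair (a b : Val) : Val

/-- The number of symbols needed to write down a value, numbers being written in binary. -/
def Val.size : Val → ℕ
  | .num n => Nat.size n + 1
  | .pair a b => a.size + b.size + 1

/-- Elementary operations. -/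
inductive Op : Type
  | id
  | const (v : Val)
  | fst
  | snd
  | isNum
  | add
  | sub
  | mul
  | div
  | le

/-- The effect of an elementary operation. Arithmetic is that of natural numbers (truncated
subtraction, division rounded down, `n / 0 = 0`); `0` is false and `1` is true; an operation applied
to an argument of the wrong shape returns `0`. -/
def Op.eval : Op → Val → Val
  | .id, x => x
  | .const v, _ => v
  | .fst, .pair a _ => a
  | .snd, .pair _ b => b
  | .isNum, .num _ => .num 1
  | .isNum, .pair _ _ => .num 0
  | .add, .pair (.num a) (.num b) => .num (a + b)
  | .sub, .pair (.num a) (.num b) => .num (a - b)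
  | .mul, .pair (.num a) (.num b) => .num (a * b)
  | .div, .pair (.num a) (.num b) => .num (a / b)
  | .le, .pair (.num a) (.num b) => .num (if a ≤ b then 1 else 0)
  | _, _ => .num 0

/-- Programs. A program takes one value and, if it halts, returns one value. -/
inductive Prog : Type
  /-- an elementary operation -/
  | op (o : Op) : Prog
  /-- first `p`, then `q` on the result of `p` -/
  | comp (p q : Prog) : Prog
  /-- run `p` and `q` on the same argument and pair the results -/
  | pair (p q : Prog) : Prog
  /-- run `p` if the test `c` does not return `0`, and `q` otherwise -/
  | ite (c p q : Prog) : Prog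
  /-- as long as the test `c` does not return `0`, replace the current value by that of `p` -/
  | loop (c p : Prog) : Prog

/-- `Run p x y t`: on argument `x` the program `p` halts with result `y` at total cost `t`. -/
inductive Run : Prog → Val → Val → ℕ → Prop
  | op (o : Op) (x : Val) : Run (.op o) x (o.eval x) (x.size + (o.eval x).size)
  | comp {p q : Prog} {x y z : Val} {t u : ℕ} (hp : Run p x y t) (hq : Run q y z u) :
      Run (.comp p q) x z (t + u + 1)
  | pair {p q : Prog} {x y z : Val} {t u : ℕ} (hp : Run p x y t) (hq : Run q x z u) :
      Run (.pair p q) x (.pair y z) (t + u + x.size + 1)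
  | ite_true {c p q : Prog} {x v y : Val} {t u : ℕ} (hc : Run c x v t) (hv : v ≠ .num 0)
      (hp : Run p x y u) : Run (.ite c p q) x y (t + u + x.size + 1)
  | ite_false {c p q : Prog} {x y : Val} {t u : ℕ} (hc : Run c x (.num 0) t)
      (hq : Run q x y u) : Run (.ite c p q) x y (t + u + x.size + 1)
  | loop_stop {c p : Prog} {x : Val} {t : ℕ} (hc : Run c x (.num 0) t) :
      Run (.loop c p) x x (t + x.size + 1)
  | loop_step {c p : Prog} {x v y z : Val} {t u w : ℕ} (hc : Run c x v t) (hv : v ≠ .num 0)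
      (hp : Run p x y u) (hl : Run (.loop c p) y z w) :
      Run (.loop c p) x z (t + u + w + x.size + 1)

/-- `SolvesInPolyTime prog enc good`: on the code of every input `x : α`, the program `prog` halts
within a number of steps bounded by a fixed polynomial in the length of that code, and its output `y`
satisfies the specification `good x y`. -/
def SolvesInPolyTime {α : Type} (prog : Prog) (enc : α → Val) (good : α → Val → Prop) : Prop :=
  ∃ P : Polynomial ℕ, ∀ x : α, ∃ (y : Val) (t : ℕ),
    Run prog (enc x) y t ∧ t ≤ P.eval (enc x).size ∧ good x y

/-- The code of a list: `0` for the empty list, head paired with tail otherwise. -/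
def encodeList : List Val → Val
  | [] => .num 0
  | v :: l => .pair v (encodeList l)

/-- The code of a nonnegative rational: numerator and denominator in lowest terms. -/
def encodeRat (q : ℚ≥0) : Val :=
  .pair (.num q.num) (.num q.den)

/-! ### Uniformly related machines with activation costs -/

/-- An instance: `n` jobs with processing requirements `p j > 0`, and `m` machines with speeds
`s i > 0` and activation costs `a i ≥ 0`; all numbers are rational. -/
structure RelatedInstance : Type where
  n : ℕ
  m : ℕ
  p : Fin n → ℚ≥0
  s : Fin m → ℚ≥0
  a : Fin m → ℚ≥0
  p_pos : ∀ j, 0 < p j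
  s_pos : ∀ i, 0 < s i

/-- The code of an instance: the list of the requirements of the jobs, and the list of the pairs
(speed, activation cost) of the machines. -/
def RelatedInstance.encode (I : RelatedInstance) : Val :=
  .pair (encodeList (List.ofFn fun j => encodeRat (I.p j)))
    (encodeList (List.ofFn fun i => .pair (encodeRat (I.s i)) (encodeRat (I.a i))))

/-- A schedule: a set of machines to activate, and an assignment of all jobs to active machines. -/
structure Schedule (I : RelatedInstance) : Type where
  active : Finset (Fin I.m)
  assign : Fin I.n → Fin I.m
  assign_mem : ∀ j, assign j ∈ active

namespace Schedule

variable {I : RelatedInstance}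

/-- The activation cost: the sum of the costs of the activated machines. -/
def cost (σ : Schedule I) : ℚ≥0 :=
  ∑ i ∈ σ.active, I.a i

/-- The time at which machine `i` completes its jobs; job `j` takes time `p j / s i` on it. -/
def load (σ : Schedule I) (i : Fin I.m) : ℚ≥0 :=
  ∑ j with σ.assign j = i, I.p j / I.s i

/-- The makespan: the time at which all jobs are complete. -/
def makespan (σ : Schedule I) : ℚ≥0 :=
  Finset.univ.sup σ.load

/-- The code of a schedule: the list of the indicators of activity of the machines, and the list of
the (indices of the) machines to which the jobs are assigned. -/
def encode (σ : Schedule I) : Val :=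
  .pair (encodeList (List.ofFn fun i => .num (if i ∈ σ.active then 1 else 0)))
    (encodeList (List.ofFn fun j => .num (σ.assign j : ℕ)))

end Schedule

end MachineActivation

/-!
The proof has two parts: a dynamic program that solves both problems, and a small calculus of
polynomial-time functions which turns it into programs of the given language.

*The dynamic program.* All data are multiplied by a common denominator, so that a makespan bound
`x / y` means that machine `i` has the integral capacity `c = s i * x` for jobs of the integral sizes
`p j * y`. Fix a large integer `N`. The sizes are rounded down to numbers `q * 2 ^ e` with
`q < 2 * N`, at the price of a factor `1 + 1 / N`; then a machine of capacity `c` sees only boundedly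
many sizes between `c / N` and `c`. The machines are considered in the order of their capacities,
and partial assignments are kept. Call a job *small* for `c` if its size is at most `c / N`. A
small job remains small for all later machines, so of the unassigned small jobs only the total volume
matters, whereas at most `N` large jobs fit on a machine. An extension to the next machine places at
most `N` large jobs there in all possible ways and then adds small jobs greedily until the
load is at least `(1 + 1 / N) * c`. Among the partial assignments with the same numbers of unassigned
large jobs of every size and the same volume of unassigned small jobs, measured in units of
`c / (N * m)` and rounded up, only a cheapest one is kept; so their number is polynomial
(`length_le_of_nodup_key`). Since the capacities increase, the rounding errors of up to `m` idle
machines add up to at most `c / N` at the next machine that is used, and there the extra space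
`c / N` makes up for all of them (`exists_extension`). Hence, along any schedule that respects the
bound, the dynamic program keeps a partial assignment that is no more expensive and, up to this
error, leaves no more to do (`exists_mem_foldl_extend`), while the load of no machine exceeds `(1 + 2 / N) * c`
(`isPartial_of_mem_foldl`).

If the makespan bound is given, a cheapest total assignment is returned (`minCost_spec`). If the
activation budget is given, the makespans `k / N * (p j / s i)` with `k ≤ N * n` are tried: the
makespan of a schedule is between once and `n` times the time of the largest job on a critical
machine, so one of them exceeds it by at most a factor `1 + 1 / N` (`exists_mem_candidates`), and the
assignment for the smallest makespan that meets the budget is returned (`minMakespan_spec`).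

*Running times.* `PolyTime f` says that some program computes `f`, on codes, in polynomial time. Such
functions are closed under composition, case distinction, and under while loops and folds over lists
whose intermediate values are polynomially bounded (`PolyTime.iterate`, `PolyTime.foldl_of_bdd`). The
algorithm is written with these operations, and `fun_prop` assembles the programs; the only fold that
needs a bound of its own is the one over the machines (`PolyTime.solutions`).
-/

namespace MachineActivation

/-! ### Running times -/

theorem Val.size_pos (v : Val) : 0 < v.size := by
  cases v <;> simp [Val.size]

theorem Run.size_le {p : Prog} {x y : Val} {t : ℕ} (h : Run p x y t) : y.size ≤ t := by
  induction h <;> (try simp only [Val.size]) <;> omega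

theorem eval_mono (P : Polynomial ℕ) {a b : ℕ} (h : a ≤ b) : P.eval a ≤ P.eval b := by
  induction P using Polynomial.induction_on' with
  | add p q hp hq => simpa using add_le_add hp hq
  | monomial n c => simpa using Nat.mul_le_mul_left c (Nat.pow_le_pow_left h n)

/-- Types whose elements are given to programs by a code. The instances below agree with the codes of
instances and schedules; Booleans are coded as the results of tests. -/
class Enc (α : Type) where
  enc : α → Val

open Enc

instance : Enc ℕ := ⟨.num⟩
instance : Enc Bool := ⟨fun b => .num (if b then 1 else 0)⟩
instance {α β : Type} [Enc α] [Enc β] : Enc (α × β) := ⟨fun x => .pair (enc x.1) (enc x.2)⟩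
instance {α : Type} [Enc α] : Enc (List α) := ⟨fun l => encodeList (l.map enc)⟩

/-- The length of the code of `a`. -/
def sz {α : Type} [Enc α] (a : α) : ℕ := (enc a).size

section

variable {α β γ δ σ : Type} [Enc α] [Enc β] [Enc γ] [Enc δ] [Enc σ]

theorem sz_pos (a : α) : 0 < sz a := Val.size_pos _

@[simp] theorem sz_nat (n : ℕ) : sz n = Nat.size n + 1 := rfl
@[simp] theorem sz_pair (a : α) (b : β) : sz (a, b) = sz a + sz b + 1 := rfl
theorem sz_prod (a : α × β) : sz a = sz a.1 + sz a.2 + 1 := rfl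
@[simp] theorem sz_nil : sz ([] : List α) = 1 := rfl
@[simp] theorem sz_cons (a : α) (l : List α) : sz (a :: l) = sz a + sz l + 1 := rfl

theorem sz_append (l l' : List α) : sz (l ++ l') + 1 = sz l + sz l' := by
  induction l with
  | nil => simp; omega
  | cons a l ih => simp; omega

theorem length_le_sz (l : List α) : l.length ≤ sz l := by
  induction l with
  | nil => simp
  | cons a l ih => simp; omega

theorem sz_le_of_mem {a : α} {l : List α} (h : a ∈ l) : sz a ≤ sz l := by
  induction l with
  | nil => simp at h
  | cons b l ih =>
    rcases List.mem_cons.1 h with rfl | h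
    · simp; omega
    · have := ih h
      simp; omega

theorem sz_le_of_forall {l : List α} {B : ℕ} (h : ∀ a ∈ l, sz a ≤ B) :
    sz l ≤ l.length * (B + 1) + 1 := by
  induction l with
  | nil => simp
  | cons b l ih =>
    have h1 := ih fun a ha => h a (List.mem_cons_of_mem _ ha)
    have h2 := h b List.mem_cons_self
    simp [add_mul]; omega

theorem sz_sublist {l l' : List α} (h : l.Sublist l') : sz l ≤ sz l' := by
  induction h with
  | slnil => simp
  | cons a _ ih => simp; omega
  | cons_cons a _ ih => simp; omega

/-- `f` is computed by a program in time polynomial in the length of the code of the argument. -/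
@[fun_prop]
def PolyTime (f : α → β) : Prop :=
  ∃ (p : Prog) (P : Polynomial ℕ), ∀ a, ∃ t, Run p (enc a) (enc (f a)) t ∧ t ≤ P.eval (sz a)

/-- `f` is bounded by a polynomial in the length of the code of the argument. -/
def PolyBdd (f : α → ℕ) : Prop := ∃ P : Polynomial ℕ, ∀ a, f a ≤ P.eval (sz a)

namespace PolyBdd

theorem mono {f g : α → ℕ} (hg : PolyBdd g) (h : ∀ a, f a ≤ g a) : PolyBdd f :=
  let ⟨P, hP⟩ := hg
  ⟨P, fun a => (h a).trans (hP a)⟩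

theorem const (c : ℕ) : PolyBdd fun _ : α => c := ⟨Polynomial.C c, by simp⟩

theorem add {f g : α → ℕ} (hf : PolyBdd f) (hg : PolyBdd g) : PolyBdd fun a => f a + g a :=
  let ⟨P, hP⟩ := hf
  let ⟨Q, hQ⟩ := hg
  ⟨P + Q, fun a => by simpa using add_le_add (hP a) (hQ a)⟩

theorem mul {f g : α → ℕ} (hf : PolyBdd f) (hg : PolyBdd g) : PolyBdd fun a => f a * g a :=
  let ⟨P, hP⟩ := hf
  let ⟨Q, hQ⟩ := hg
  ⟨P * Q, fun a => by simpa using Nat.mul_le_mul (hP a) (hQ a)⟩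

theorem pow {f : α → ℕ} (hf : PolyBdd f) (k : ℕ) : PolyBdd fun a => f a ^ k :=
  let ⟨P, hP⟩ := hf
  ⟨P ^ k, fun a => by simpa using Nat.pow_le_pow_left (hP a) k⟩

theorem sz : PolyBdd fun a : α => sz a := ⟨Polynomial.X, by simp⟩

theorem eval {f : α → ℕ} (hf : PolyBdd f) (P : Polynomial ℕ) : PolyBdd fun a => P.eval (f a) :=
  let ⟨Q, hQ⟩ := hf
  ⟨P.comp Q, fun a => by simpa using eval_mono P (hQ a)⟩

end PolyBdd

theorem PolyTime.polyBdd {f : α → β} (hf : PolyTime f) : PolyBdd fun a => sz (f a) := by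
  obtain ⟨p, P, h⟩ := hf
  refine ⟨P, fun a => ?_⟩
  obtain ⟨t, h1, h2⟩ := h a
  exact h1.size_le.trans h2

theorem PolyBdd.comp {f : β → ℕ} {g : α → β} (hf : PolyBdd f) (hg : PolyTime g) :
    PolyBdd fun a => f (g a) :=
  let ⟨P, hP⟩ := hf
  ((hg.polyBdd).eval P).mono fun a => hP (g a)

/-- To bound running times it suffices to do so by any polynomially bounded function. -/
theorem PolyTime.of_run {f : α → β} (p : Prog) {T : α → ℕ} (hT : PolyBdd T)
    (h : ∀ a, ∃ t, Run p (enc a) (enc (f a)) t ∧ t ≤ T a) : PolyTime f := by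
  obtain ⟨P, hP⟩ := hT
  refine ⟨p, P, fun a => ?_⟩
  obtain ⟨t, h1, h2⟩ := h a
  exact ⟨t, h1, h2.trans (hP a)⟩

/-- A program for `f` together with a polynomially bounded running time. -/
theorem PolyTime.exists_run {f : α → β} (hf : PolyTime f) :
    ∃ (p : Prog) (T : α → ℕ), PolyBdd T ∧ ∀ a, Run p (enc a) (enc (f a)) (T a) := by
  obtain ⟨p, P, h⟩ := hf
  choose T h1 h2 using h
  exact ⟨p, T, ⟨P, h2⟩, h1⟩

namespace PolyTime

/-- A function given by an elementary operation, with a bound on the size of the result. -/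
theorem of_op {f : α → β} (o : Op) (h : ∀ a, o.eval (enc a) = enc (f a))
    (hb : PolyBdd fun a => sz (f a)) : PolyTime f :=
  of_run (.op o) (PolyBdd.sz.add hb) fun a => by
    have := Run.op o (enc a)
    rw [h] at this
    exact ⟨_, this, le_rfl⟩

@[fun_prop]
theorem id' : PolyTime fun a : α => a :=
  of_op .id (fun _ => rfl) PolyBdd.sz

@[fun_prop]
theorem const (b : β) : PolyTime fun _ : α => b :=
  of_op (.const (enc b)) (fun _ => rfl) (PolyBdd.const _)

@[fun_prop]
theorem comp {f : β → γ} {g : α → β} (hf : PolyTime f) (hg : PolyTime g) :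
    PolyTime fun a => f (g a) := by
  obtain ⟨p, T, hT, hp⟩ := hf.exists_run
  obtain ⟨q, U, hU, hq⟩ := hg.exists_run
  exact of_run (.comp q p) ((hU.add (hT.comp hg)).add (.const 1))
    fun a => ⟨_, Run.comp (hq a) (hp (g a)), le_rfl⟩

@[fun_prop]
theorem prodMk {f : α → β} {g : α → γ} (hf : PolyTime f) (hg : PolyTime g) :
    PolyTime fun a => (f a, g a) := by
  obtain ⟨p, T, hT, hp⟩ := hf.exists_run
  obtain ⟨q, U, hU, hq⟩ := hg.exists_run
  exact of_run (.pair p q) (((hT.add hU).add .sz).add (.const 1))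
    fun a => ⟨_, Run.pair (hp a) (hq a), le_rfl⟩

@[fun_prop]
theorem fst : PolyTime fun a : α × β => a.1 :=
  of_op .fst (fun _ => rfl) (PolyBdd.sz.mono fun a => by rw [sz_prod a]; omega)

@[fun_prop]
theorem snd : PolyTime fun a : α × β => a.2 :=
  of_op .snd (fun _ => rfl) (PolyBdd.sz.mono fun a => by rw [sz_prod a]; omega)

theorem comp₂ {f : β → γ → δ} (hf : PolyTime fun x : β × γ => f x.1 x.2) {g : α → β} {h : α → γ}
    (hg : PolyTime g) (hh : PolyTime h) : PolyTime fun a => f (g a) (h a) :=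
  comp hf (prodMk hg hh)

theorem cond {c : α → Bool} {f g : α → β} (hc : PolyTime c) (hf : PolyTime f) (hg : PolyTime g) :
    PolyTime fun a => if c a then f a else g a := by
  obtain ⟨p, T, hT, hp⟩ := hf.exists_run
  obtain ⟨q, U, hU, hq⟩ := hg.exists_run
  obtain ⟨r, V, hV, hr⟩ := hc.exists_run
  refine of_run (.ite r p q) ((((hV.add hT).add hU).add .sz).add (.const 1)) fun a => ?_
  have h := hr a
  cases hca : c a
  · rw [hca] at h
    exact ⟨_, Run.ite_false h (hq a), by simp only [sz]; omega⟩
  · rw [hca] at h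
    exact ⟨_, Run.ite_true h (by simp [enc]) (hp a), by simp only [sz]; omega⟩

/-! ### Arithmetic -/

theorem size_add_le (a b : ℕ) : Nat.size (a + b) ≤ Nat.size a + Nat.size b + 1 := by
  rw [Nat.size_le, pow_succ, pow_add]
  have h1 := Nat.lt_size_self a
  have h2 := Nat.lt_size_self b
  nlinarith

theorem size_mul_le (a b : ℕ) : Nat.size (a * b) ≤ Nat.size a + Nat.size b := by
  rw [Nat.size_le, pow_add]
  exact Nat.mul_lt_mul'' (Nat.lt_size_self a) (Nat.lt_size_self b)

@[fun_prop]
theorem add {f g : α → ℕ} (hf : PolyTime f) (hg : PolyTime g) : PolyTime fun a => f a + g a :=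
  comp₂ (f := fun x y : ℕ => x + y) (of_op .add (fun _ => rfl) ((PolyBdd.sz).mono fun a => by
    rw [sz_prod a]; simpa using (size_add_le a.1 a.2).trans (by omega))) hf hg

@[fun_prop]
theorem sub {f g : α → ℕ} (hf : PolyTime f) (hg : PolyTime g) : PolyTime fun a => f a - g a :=
  comp₂ (f := fun x y : ℕ => x - y) (of_op .sub (fun _ => rfl) ((PolyBdd.sz).mono fun a => by
    rw [sz_prod a]; simpa using (Nat.size_le_size (Nat.sub_le a.1 a.2)).trans (by omega))) hf hg

@[fun_prop]
theorem mul {f g : α → ℕ} (hf : PolyTime f) (hg : PolyTime g) : PolyTime fun a => f a * g a :=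
  comp₂ (f := fun x y : ℕ => x * y) (of_op .mul (fun _ => rfl) ((PolyBdd.sz).mono fun a => by
    rw [sz_prod a]; simpa using (size_mul_le a.1 a.2).trans (by omega))) hf hg

@[fun_prop]
theorem div {f g : α → ℕ} (hf : PolyTime f) (hg : PolyTime g) : PolyTime fun a => f a / g a :=
  comp₂ (f := fun x y : ℕ => x / y) (of_op .div (fun _ => rfl) ((PolyBdd.sz).mono fun a => by
    rw [sz_prod a]; simpa using (Nat.size_le_size (Nat.div_le_self a.1 a.2)).trans (by omega))) hf hg

end PolyTime

/-! ### Decidable predicates -/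

/-- The predicate `p` is decided in polynomial time. -/
@[fun_prop]
def PolyDec (p : α → Prop) : Prop := ∃ c : α → Bool, PolyTime c ∧ ∀ a, c a = true ↔ p a

namespace PolyDec

theorem of_iff {p q : α → Prop} (hp : PolyDec p) (h : ∀ a, q a ↔ p a) : PolyDec q :=
  let ⟨c, hc, hcp⟩ := hp
  ⟨c, hc, fun a => (hcp a).trans (h a).symm⟩

@[fun_prop]
theorem le {f g : α → ℕ} (hf : PolyTime f) (hg : PolyTime g) : PolyDec fun a => f a ≤ g a := by
  refine ⟨fun a => decide (f a ≤ g a), PolyTime.comp₂ (f := fun x y : ℕ => decide (x ≤ y))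
    (.of_op .le (fun a => ?_) ((PolyBdd.const 2).mono fun a => ?_)) hf hg, by simp⟩
  · simp [enc, Op.eval]
  · have : Nat.size 1 = 1 := by decide
    by_cases h : a.1 ≤ a.2 <;> simp [sz, enc, Val.size, h, this]

@[fun_prop]
theorem const (p : Prop) : PolyDec fun _ : α => p := by
  classical
  exact ⟨fun _ => decide p, .const _, by simp⟩

theorem ite {c p q : α → Prop} (hc : PolyDec c) (hp : PolyDec p) (hq : PolyDec q) :
    PolyDec fun a => (c a → p a) ∧ (¬ c a → q a) := by
  obtain ⟨c', hc', h⟩ := hc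
  obtain ⟨p', hp', h'⟩ := hp
  obtain ⟨q', hq', h''⟩ := hq
  refine ⟨fun a => if c' a then p' a else q' a, hc'.cond hp' hq', fun a => ?_⟩
  simp only [← h, ← h', ← h'']
  cases c' a <;> simp

@[fun_prop]
theorem imp {p q : α → Prop} (hp : PolyDec p) (hq : PolyDec q) : PolyDec fun a => p a → q a :=
  (hp.ite hq (.const True)).of_iff (by simp)

@[fun_prop]
theorem not {p : α → Prop} (hp : PolyDec p) : PolyDec fun a => ¬ p a :=
  (hp.imp (.const False)).of_iff (by simp)

@[fun_prop]
theorem and {p q : α → Prop} (hp : PolyDec p) (hq : PolyDec q) : PolyDec fun a => p a ∧ q a :=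
  (hp.ite hq (.const False)).of_iff (fun a => by by_cases h : p a <;> simp [h])

@[fun_prop]
theorem lt {f g : α → ℕ} (hf : PolyTime f) (hg : PolyTime g) : PolyDec fun a => f a < g a :=
  (le hg hf).not.of_iff (by simp)

@[fun_prop]
theorem natEq {f g : α → ℕ} (hf : PolyTime f) (hg : PolyTime g) : PolyDec fun a => f a = g a :=
  ((le hf hg).and (le hg hf)).of_iff (fun _ => le_antisymm_iff)

end PolyDec

@[fun_prop]
theorem PolyTime.ite {c : α → Prop} [∀ a, Decidable (c a)] {f g : α → β} (hc : PolyDec c)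
    (hf : PolyTime f) (hg : PolyTime g) : PolyTime fun a => if c a then f a else g a := by
  obtain ⟨c', hc', h⟩ := hc
  convert hc'.cond hf hg using 3 with a
  exact (h a).symm

end

section

variable {α β γ δ σ : Type} [Enc α] [Enc β] [Enc γ] [Enc δ] [Enc σ]

/-! ### Loops and lists -/

theorem exists_bound_of_mem {F : α → β → ℕ} {l : α → List β}
    (hF : PolyBdd fun x : α × β => F x.1 x.2) (hl : PolyTime l) :
    ∃ B : α → ℕ, PolyBdd B ∧ ∀ a, ∀ b ∈ l a, F a b ≤ B a := by
  obtain ⟨P, hP⟩ := hF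
  refine ⟨_, ((PolyBdd.sz.add hl.polyBdd).add (.const 1)).eval P, fun a b hb => ?_⟩
  refine (hP (a, b)).trans (eval_mono P ?_)
  have := sz_le_of_mem hb
  simp only [sz_pair]; omega

namespace PolyTime

/-- A while loop runs in polynomial time if the number of rounds and the sizes of the intermediate
values are polynomially bounded. -/
theorem iterate {c : α → Prop} {g : α → α} {init : δ → α} {k B : δ → ℕ} (hc : PolyDec c)
    (hg : PolyTime g) (hinit : PolyTime init) (hk : PolyBdd k) (hB : PolyBdd B)
    (hsz : ∀ d, ∀ i ≤ k d, sz (g^[i] (init d)) ≤ B d)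
    (hgo : ∀ d, ∀ i < k d, c (g^[i] (init d))) (hdone : ∀ d, ¬ c (g^[k d] (init d))) :
    PolyTime fun d => g^[k d] (init d) := by
  obtain ⟨c', ⟨q, Q, hq⟩, hc'⟩ := hc
  obtain ⟨p, P, hp⟩ := hg
  obtain ⟨r, T, hT, hr⟩ := hinit.exists_run
  have key : ∀ (n : ℕ) (x : α) (b : ℕ), (∀ i ≤ n, sz (g^[i] x) ≤ b) → (∀ i < n, c (g^[i] x)) →
      ¬ c (g^[n] x) → ∃ t, Run (.loop q p) (enc x) (enc (g^[n] x)) t ∧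
        t ≤ (n + 1) * (P.eval b + Q.eval b + b + 1) := by
    intro n
    induction n with
    | zero =>
      intro x b h1 _ h3
      obtain ⟨t, ht, htQ⟩ := hq x
      have h0 := h1 0 le_rfl
      have hx : c' x = false := by simpa [← hc'] using h3
      rw [hx] at ht
      refine ⟨_, Run.loop_stop ht, ?_⟩
      have := htQ.trans (eval_mono Q h0)
      simp only [Function.iterate_zero, id, sz] at h0
      omega
    | succ n ih =>
      intro x b h1 h2 h3
      obtain ⟨t, ht, htQ⟩ := hq x
      obtain ⟨u, hu, huP⟩ := hp x
      obtain ⟨w, hw, hwb⟩ := ih (g x) b (fun i hi => h1 (i + 1) (by omega))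
        (fun i hi => h2 (i + 1) (by omega)) h3
      have h0 := h1 0 (by omega)
      have hx : c' x = true := (hc' x).2 (h2 0 (by omega))
      rw [hx] at ht
      refine ⟨_, Run.loop_step ht (by simp [enc]) hu hw, ?_⟩
      have h4 := htQ.trans (eval_mono Q h0)
      have h5 := huP.trans (eval_mono P h0)
      simp only [Function.iterate_zero, id, sz] at h0
      rw [add_mul, one_mul]
      omega
  choose t ht htb using fun d => key (k d) (init d) (B d) (hsz d) (hgo d) (hdone d)
  refine of_run (.comp r (.loop q p)) ((hT.add ((hk.add (.const 1)).mul
    ((((hB.eval P).add (hB.eval Q)).add hB).add (.const 1)))).add (.const 1)) fun d =>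
    ⟨_, Run.comp (hr d) (ht d), ?_⟩
  have := htb d
  omega

/-- Case distinction on a list, in the form of equations for the resulting function `h`. -/
theorem listCases {l : α → List β} {f h : α → γ} {g : α → β × List β → γ} (hl : PolyTime l)
    (hf : PolyTime f) (hg : PolyTime fun x : α × (β × List β) => g x.1 x.2)
    (h_nil : ∀ a, l a = [] → h a = f a) (h_cons : ∀ a b t, l a = b :: t → h a = g a (b, t)) :
    PolyTime h := by
  obtain ⟨p, P, hp⟩ := hl
  obtain ⟨q, Q, hq⟩ := hf
  obtain ⟨r, R, hr⟩ := hg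
  -- the code of the empty list is a number, that of any other list is the pair of head and tail
  refine of_run (.ite (.comp p (.op .isNum)) q (.comp (.pair (.op .id) p) r))
    (T := fun a => 2 * P.eval (sz a) + P.eval (sz a) + Q.eval (sz a) +
      R.eval (sz a + P.eval (sz a) + 1) + 4 * sz a + 100) ?_ fun a => ?_
  · have h1 := (PolyBdd.sz (α := α)).eval P
    exact (((((PolyBdd.const 2).mul h1).add h1).add (PolyBdd.sz.eval Q)).add
      (((PolyBdd.sz.add h1).add (.const 1)).eval R)).add ((PolyBdd.const 4).mul .sz) |>.add (.const _)
  · obtain ⟨t, ht, htP⟩ := hp a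
    have hs1 : Nat.size 1 = 1 := by decide
    have hle := ht.size_le
    cases hla : l a with
    | nil =>
      rw [h_nil a hla]
      rw [hla] at ht hle
      obtain ⟨u, hu, huQ⟩ := hq a
      have h1 : Run (.op .isNum) (enc ([] : List β)) (.num 1) _ := Run.op .isNum (.num 0)
      refine ⟨_, Run.ite_true (Run.comp ht h1) (by simp) hu, ?_⟩
      simp only [Op.eval, Val.size, Nat.size_zero, hs1]
      change _ + sz a + 1 ≤ _
      omega
    | cons b s =>
      rw [h_cons a b s hla]
      rw [hla] at ht hle
      obtain ⟨u, hu, huR⟩ := hr (a, (b, s))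
      have h1 : Run (.op .isNum) (enc (b :: s)) (.num 0) _ := Run.op .isNum (.pair (enc b) (enc s))
      have h2 : Run (.pair (.op .id) p) (enc a) (enc (a, (b, s))) _ :=
        Run.pair (Run.op .id (enc a)) ht
      refine ⟨_, Run.ite_false (Run.comp ht h1) (Run.comp h2 hu), ?_⟩
      have h3 : sz (a, (b, s)) ≤ sz a + P.eval (sz a) + 1 := by
        have : sz (b, s) ≤ P.eval (sz a) := hle.trans htP
        simp only [sz_pair] at *; omega
      have h4 := huR.trans (eval_mono R h3)
      have h5 : (Val.pair (enc b) (enc s)).size ≤ t := hle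
      simp only [Op.eval, Val.size, Nat.size_zero] at h5 ⊢
      have h6 : sz a = (enc a).size := rfl
      omega

/-- Folding over a list takes polynomial time if the steps do and all accumulators that occur are
polynomially bounded. -/
theorem foldl_of_bdd {l : α → List β} {s : α → σ} {step : α → σ → β → σ} {B : α → ℕ}
    (hl : PolyTime l) (hs : PolyTime s)
    (hstep : PolyTime fun x : α × σ × β => step x.1 x.2.1 x.2.2) (hB : PolyBdd B)
    (h : ∀ a l₁ l₂, l a = l₁ ++ l₂ → sz (l₁.foldl (step a) (s a)) ≤ B a) :
    PolyTime fun a => (l a).foldl (step a) (s a) := by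
  let g : List β × α × σ → List β × α × σ := fun x =>
    match x.1 with
      | [] => x
      | b :: t => (t, x.2.1, step x.2.1 x.2.2 b)
  have hg : PolyTime g := by
    refine listCases (l := fun x : List β × α × σ => x.1) (f := fun x => x)
      (g := fun x y => (y.2, x.2.1, step x.2.1 x.2.2 y.1)) (by fun_prop) (by fun_prop) ?_
      (fun x hx => by simp [g, hx]) (fun x b t hx => by simp [g, hx])
    have := comp₂ (f := fun (a : α) (y : σ × β) => step a y.1 y.2) hstep
      (g := fun x : (List β × α × σ) × (β × List β) => x.1.2.1)
      (h := fun x => (x.1.2.2, x.2.1)) (by fun_prop) (by fun_prop)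
    fun_prop
  have hit : ∀ (i : ℕ) (l' : List β) (a : α) (s' : σ),
      g^[i] (l', a, s') = (l'.drop i, a, (l'.take i).foldl (step a) s') := by
    intro i
    induction i with
    | zero => simp
    | succ i ih =>
      intro l' a s'
      cases l' with
      | nil => simpa [g] using ih [] a s'
      | cons b t => simpa [g] using ih t a (step a s' b)
  have hc : PolyDec fun x : List β × α × σ => x.1 ≠ [] := by
    refine ⟨fun x => !x.1.isEmpty, listCases (l := fun x : List β × α × σ => x.1)
      (f := fun _ => false) (g := fun _ _ => true) (by fun_prop) (by fun_prop) (by fun_prop)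
      (fun x hx => by simp [hx]) (fun x b t hx => by simp [hx]), fun x => by simp⟩
  have := iterate (c := fun x : List β × α × σ => x.1 ≠ []) (g := g)
    (init := fun a => (l a, a, s a)) (k := fun a => (l a).length)
    (B := fun a => sz (l a) + (sz a + B a + 1) + 1) hc hg (by fun_prop)
    (hl.polyBdd.mono fun a => length_le_sz _)
    ((hl.polyBdd.add ((PolyBdd.sz.add hB).add (.const 1))).add (.const 1)) ?_ ?_ ?_
  · have h2 : PolyTime fun a => (g^[(l a).length] (l a, a, s a)).2.2 := by fun_prop
    simpa [hit] using h2
  · intro a i hi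
    have h1 := h a _ _ (List.take_append_drop i (l a)).symm
    have h2 := sz_sublist (List.drop_sublist i (l a))
    simp only [hit, sz_pair]; omega
  · intro a i hi
    simpa [hit] using hi
  · intro a
    simp [hit]

/-- Folding over a list takes polynomial time if the steps do and the size of the accumulator
increases by a polynomially bounded amount in every step. -/
theorem foldl_of_incr {l : α → List β} {s : α → σ} {step : α → σ → β → σ} {B : α → ℕ}
    (hl : PolyTime l) (hs : PolyTime s)
    (hstep : PolyTime fun x : α × σ × β => step x.1 x.2.1 x.2.2) (hB : PolyBdd B)
    (h : ∀ a s, ∀ b ∈ l a, sz (step a s b) ≤ sz s + B a) :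
    PolyTime fun a => (l a).foldl (step a) (s a) := by
  refine foldl_of_bdd (B := fun a => sz (s a) + sz (l a) * B a) hl hs hstep
    (hs.polyBdd.add (hl.polyBdd.mul hB)) fun a l₁ l₂ hla => ?_
  have key : ∀ (l₁ : List β) (s' : σ), (∀ b ∈ l₁, b ∈ l a) →
      sz (l₁.foldl (step a) s') ≤ sz s' + l₁.length * B a := by
    intro l₁
    induction l₁ with
    | nil => simp
    | cons b t ih =>
      intro s' hm
      have h1 := ih (step a s' b) fun b hb => hm b (List.mem_cons_of_mem _ hb)
      have h2 := h a s' b (hm b List.mem_cons_self)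
      simp only [List.foldl_cons, List.length_cons, add_mul, one_mul]
      omega
  refine (key l₁ (s a) (by simp +contextual [hla])).trans ?_
  have : l₁.length ≤ sz (l a) := le_trans (by simp [hla]) (length_le_sz (l a))
  gcongr

@[fun_prop]
theorem cons {f : α → β} {l : α → List β} (hf : PolyTime f) (hl : PolyTime l) :
    PolyTime fun a => f a :: l a := by
  obtain ⟨p, T, hT, hp⟩ := hf.exists_run
  obtain ⟨q, U, hU, hq⟩ := hl.exists_run
  exact of_run (.pair p q) (((hT.add hU).add .sz).add (.const 1))
    fun a => ⟨_, Run.pair (hp a) (hq a), le_rfl⟩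

@[fun_prop]
theorem reverse {l : α → List β} (hl : PolyTime l) : PolyTime fun a => (l a).reverse := by
  have := foldl_of_incr (s := fun _ => ([] : List β)) (step := fun _ s b => b :: s)
    (B := fun a => sz (l a) + 1) hl (by fun_prop) (by fun_prop) (hl.polyBdd.add (.const 1))
    fun a s b hb => by have := sz_le_of_mem hb; simp; omega
  simpa using this

@[fun_prop]
theorem append {l l' : α → List β} (hl : PolyTime l) (hl' : PolyTime l') :
    PolyTime fun a => l a ++ l' a := by
  have := foldl_of_incr (s := l') (step := fun _ s b => b :: s) (l := fun a => (l a).reverse)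
    (B := fun a => sz (l a) + 1) (by fun_prop) hl' (by fun_prop) (hl.polyBdd.add (.const 1))
    fun a s b hb => by
      have := sz_le_of_mem (List.mem_reverse.1 hb)
      simp; omega
  simpa using this

@[fun_prop]
theorem flatMap {l : α → List β} {g : α → β → List γ} (hl : PolyTime l)
    (hg : PolyTime fun x : α × β => g x.1 x.2) : PolyTime fun a => (l a).flatMap (g a) := by
  obtain ⟨B, hB, hBl⟩ := exists_bound_of_mem (F := fun a b => sz (g a b)) hg.polyBdd hl
  have hg' : PolyTime fun x : α × List γ × β => g x.1 x.2.2 :=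
    comp₂ hg (g := fun x : α × List γ × β => x.1) (h := fun x => x.2.2) (by fun_prop) (by fun_prop)
  have := foldl_of_incr (s := fun _ => ([] : List γ)) (step := fun a s b => s ++ g a b) hl
    (by fun_prop) (by fun_prop) hB fun a s b hb => by
      have := sz_append s (g a b)
      have := hBl a b hb
      omega
  simpa [List.flatMap_eq_foldl] using this

@[fun_prop]
theorem map {l : α → List β} {g : α → β → γ} (hl : PolyTime l)
    (hg : PolyTime fun x : α × β => g x.1 x.2) : PolyTime fun a => (l a).map (g a) := by
  have : PolyTime fun a => (l a).flatMap fun b => [g a b] := by fun_prop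
  simpa [List.map_eq_flatMap] using this

theorem filter {l : α → List β} {p : α → β → Prop} [∀ a b, Decidable (p a b)] (hl : PolyTime l)
    (hp : PolyDec fun x : α × β => p x.1 x.2) : PolyTime fun a => (l a).filter fun b => p a b := by
  have : PolyTime fun a => (l a).flatMap fun b => if p a b then [b] else [] := by fun_prop
  convert this with a
  induction l a with
  | nil => rfl
  | cons b t ih => by_cases h : p a b <;> simp [h, ih]

@[fun_prop]
theorem sum {l : α → List ℕ} (hl : PolyTime l) : PolyTime fun a => (l a).sum := by
  have := foldl_of_incr (s := fun _ => 0) (step := fun _ s b => s + b)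
    (B := fun a => sz (l a)) hl (by fun_prop) (by fun_prop) hl.polyBdd
    fun a s b hb => by
      have := sz_le_of_mem hb
      have := size_add_le s b
      simp at *; omega
  simpa [List.sum_eq_foldl] using this

@[fun_prop]
theorem prod {l : α → List ℕ} (hl : PolyTime l) : PolyTime fun a => (l a).prod := by
  have := foldl_of_incr (s := fun _ => 1) (step := fun _ s b => s * b)
    (B := fun a => sz (l a)) hl (by fun_prop) (by fun_prop) hl.polyBdd
    fun a s b hb => by
      have := sz_le_of_mem hb
      have := size_mul_le s b
      simp at *; omega
  simpa [List.prod_eq_foldl] using this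

@[fun_prop]
theorem length {l : α → List β} (hl : PolyTime l) : PolyTime fun a => (l a).length := by
  have : PolyTime fun a => ((l a).map fun _ => 1).sum := by fun_prop
  simpa using this

end PolyTime

namespace PolyDec

@[fun_prop]
theorem eq_nil {l : α → List β} (hl : PolyTime l) : PolyDec fun a => l a = [] :=
  (natEq (f := fun a => (l a).length) (g := fun _ => 0) (by fun_prop) (by fun_prop)).of_iff
    (by simp)

theorem forall_mem {l : α → List β} {p : α → β → Prop} (hl : PolyTime l)
    (hp : PolyDec fun x : α × β => p x.1 x.2) : PolyDec fun a => ∀ b ∈ l a, p a b := by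
  classical
  refine (eq_nil (PolyTime.filter (p := fun a b => ¬ p a b) hl hp.not)).of_iff fun a => ?_
  simp [List.filter_eq_nil_iff]

theorem exists_mem {l : α → List β} {p : α → β → Prop} (hl : PolyTime l)
    (hp : PolyDec fun x : α × β => p x.1 x.2) : PolyDec fun a => ∃ b ∈ l a, p a b :=
  (forall_mem (p := fun a b => ¬ p a b) hl hp.not).not.of_iff fun a => by simp

@[fun_prop]
theorem mem {f : α → ℕ} {l : α → List ℕ} (hf : PolyTime f) (hl : PolyTime l) :
    PolyDec fun a => f a ∈ l a :=
  (exists_mem (p := fun a b => b = f a) hl (by fun_prop)).of_iff (by simp)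

end PolyDec

/-- The positions in a list. -/
def indices {β : Type*} (l : List β) : List ℕ := List.range l.length

@[simp] theorem mem_indices {β : Type*} {l : List β} {j : ℕ} : j ∈ indices l ↔ j < l.length := by
  simp [indices]

namespace PolyTime

@[fun_prop]
theorem indices {l : α → List β} (hl : PolyTime l) : PolyTime fun a => indices (l a) := by
  have key : ∀ l : List β, l.foldl (fun s _ => s ++ [s.length]) [] = MachineActivation.indices l := by
    intro l
    induction l using List.reverseRecOn with
    | nil => rfl
    | append_singleton l b ih => simp [ih, MachineActivation.indices, List.range_succ]
  have := foldl_of_bdd (s := fun _ => ([] : List ℕ)) (step := fun _ s _ => s ++ [s.length])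
    (B := fun a => sz (l a) * (sz (l a) + 1 + 1) + 1) hl (by fun_prop) (by fun_prop)
    ((hl.polyBdd.mul ((hl.polyBdd.add (.const 1)).add (.const 1))).add (.const 1))
    fun a l₁ l₂ h => ?_
  · simpa [key] using this
  · have hlen : l₁.length ≤ sz (l a) := le_trans (by simp [h]) (length_le_sz (l a))
    rw [key]
    refine (sz_le_of_forall (B := sz (l a) + 1) fun j hj => ?_).trans ?_
    · have h1 := Nat.size_le_size (mem_indices.1 hj).le
      have h2 : Nat.size l₁.length ≤ l₁.length := Nat.size_le.2 Nat.lt_two_pow_self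
      simp only [sz_nat]; omega
    · simp only [MachineActivation.indices, List.length_range]; gcongr

@[fun_prop]
theorem getD {l : α → List β} {i : α → ℕ} {d : α → β} (hl : PolyTime l) (hi : PolyTime i)
    (hd : PolyTime d) : PolyTime fun a => (l a).getD (i a) (d a) := by
  -- fold over the list with a counter, and remember the entry at which the counter equals `i`
  have key : ∀ (l : List β) (i k : ℕ) (d : β),
      l.foldl (fun (s : ℕ × β) b => (s.1 + 1, if s.1 = i then b else s.2)) (k, d) =
        (k + l.length, if k ≤ i then l.getD (i - k) d else d) := by
    intro l
    induction l with
    | nil => simp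
    | cons b t ih =>
      intro i k d
      rw [List.foldl_cons, ih, List.length_cons]
      refine Prod.ext (by simp; omega) ?_
      rcases lt_trichotomy k i with h | h | h
      · obtain ⟨e, rfl⟩ := Nat.exists_eq_add_of_lt h
        have h1 : k + e + 1 - k = e + 1 := by omega
        have h2 : k + e + 1 - (k + 1) = e := by omega
        simp [h1, h2, show k ≠ k + e + 1 by omega, show k ≤ k + e + 1 by omega, show k ≤ k + e by omega]
      · simp [h]
      · simp [show ¬ k ≤ i by omega, show ¬ k + 1 ≤ i by omega, show k ≠ i by omega]
  have := foldl_of_incr (s := fun a => (0, d a))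
    (step := fun a (s : ℕ × β) b => (s.1 + 1, if s.1 = i a then b else s.2))
    (B := fun a => sz (l a) + 2) hl (by fun_prop) (by fun_prop) (hl.polyBdd.add (.const 2))
    fun a s b hb => by
      have h1 := sz_le_of_mem hb
      have h2 := size_add_le s.1 1
      have h3 : Nat.size 1 = 1 := by decide
      rw [sz_prod s]
      by_cases h : s.1 = i a
      · simp only [h, if_true, sz_pair, sz_nat] at *; omega
      · simp only [h, if_false, sz_pair, sz_nat] at *; omega
  simp only [key] at this
  simpa using snd.comp this

@[fun_prop]
theorem set {l : α → List β} {i : α → ℕ} {b : α → β} (hl : PolyTime l) (hi : PolyTime i)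
    (hb : PolyTime b) : PolyTime fun a => (l a).set (i a) (b a) := by
  have : PolyTime fun a => (MachineActivation.indices (l a)).map fun k =>
    if k = i a then b a else (l a).getD k (b a) := by fun_prop
  convert this with a
  refine List.ext_getElem (by simp [MachineActivation.indices]) fun k h1 h2 => ?_
  have h3 : k < (l a).length := by simpa using h1
  simp only [MachineActivation.indices, List.getElem_set, List.getElem_map, List.getElem_range,
    List.getD_eq_getElem _ _ h3, eq_comm]

end PolyTime

@[fun_prop]
theorem PolyDec.listEq {l l' : α → List ℕ} (hl : PolyTime l) (hl' : PolyTime l') :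
    PolyDec fun a => l a = l' a := by
  have h1 : PolyDec fun a => (l a).length = (l' a).length := by fun_prop
  have h2 : PolyDec fun a => ∀ j ∈ indices (l a), (l a).getD j 0 = (l' a).getD j 0 :=
    forall_mem (by fun_prop) (by fun_prop)
  refine (h1.and h2).of_iff fun a => ⟨fun h => by simp [h], fun h => ?_⟩
  refine List.ext_getElem h.1 fun j h3 h4 => ?_
  simpa [h3, h4] using h.2 j (by simpa using h3)

end

/-! ### The dynamic program -/

/-- The sizes of the jobs that the partial assignment `f` places on machine `i`. Machines are
numbered from `1` on, and the entry `0` of `f` marks the jobs that have not been assigned yet, so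
that `jobsOn P f 0` lists these. -/
def jobsOn (P f : List ℕ) (i : ℕ) : List ℕ :=
  ((indices P).filter fun j => f.getD j 0 = i).map fun j => P.getD j 0

/-- The activation cost of the machines used by `f`. A machine is a triple consisting of its number,
its capacity and its activation cost. -/
def usedCost (Ms : List (ℕ × ℕ × ℕ)) (f : List ℕ) : ℕ :=
  (Ms.map fun M => if M.1 ∈ f then M.2.2 else 0).sum

/-- Adds to a list of partial assignments all those that arise by placing one more large job on
machine `i` within its capacity `c`. A job is large for `c` if its size exceeds `c / N`. -/
def expand (N : ℕ) (P : List ℕ) (i c : ℕ) (S : List (List ℕ)) : List (List ℕ) :=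
  S ++ S.flatMap fun f => (indices P).flatMap fun j =>
    if f.getD j 0 = 0 ∧ c < P.getD j 0 * N ∧ (jobsOn P f i).sum + P.getD j 0 ≤ c then [f.set j i]
    else []

/-- Greedily places unassigned small jobs on machine `i`, until its load reaches
`(1 + 1 / N) * c`. -/
def fill (N : ℕ) (P : List ℕ) (i c : ℕ) (f : List ℕ) : List ℕ :=
  (indices P).foldl (fun f j =>
    if f.getD j 0 = 0 ∧ P.getD j 0 * N ≤ c ∧ (jobsOn P f i).sum * N < c * (N + 1) then f.set j i
    else f) f

/-- The total size of the unassigned jobs that are small for `c`. -/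
def smallVol (N : ℕ) (P : List ℕ) (c : ℕ) (f : List ℕ) : ℕ :=
  ((jobsOn P f 0).filter fun p => p * N ≤ c).sum

/-- What is remembered of a partial assignment: the volume of the small unassigned jobs in units of
`c / (N * m)`, rounded up, and, for every job, the number of unassigned jobs of its size if that size
is large. -/
def key (N m : ℕ) (P : List ℕ) (c : ℕ) (f : List ℕ) : List ℕ :=
  (smallVol N P c f * (N * m) + (c - 1)) / c ::
    P.map fun p => if c < p * N then (jobsOn P f 0).count p else 0

/-- Keeps one cheapest element for every key. -/
def prune {σ κ : Type} [DecidableEq κ] (key : σ → κ) (cost : σ → ℕ) (S : List σ) : List σ :=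
  S.foldl (fun T x => if ∃ y ∈ T, key y = key x ∧ cost y ≤ cost x then T
    else x :: T.filter fun y => key y ≠ key x) []

/-- Extends partial assignments to the machine `M`: it is left idle, or it receives some large jobs,
of which there are at most `N`, and is then filled up with small ones. -/
def extend (N : ℕ) (P : List ℕ) (Ms : List (ℕ × ℕ × ℕ)) (S : List (List ℕ)) (M : ℕ × ℕ × ℕ) :
    List (List ℕ) :=
  prune (key N Ms.length P M.2.1) (usedCost Ms)
    (S ++ ((expand N P M.1 M.2.1)^[N] S).map (fill N P M.1 M.2.1))

/-- The partial assignments found after all machines have been considered. -/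
def solutions (N : ℕ) (P : List ℕ) (Ms : List (ℕ × ℕ × ℕ)) : List (List ℕ) :=
  Ms.foldl (extend N P Ms) [P.map fun _ => 0]

section

variable {α : Type} [Enc α]

namespace PolyTime

@[fun_prop]
theorem jobsOn {P f : α → List ℕ} {i : α → ℕ} (hP : PolyTime P) (hf : PolyTime f)
    (hi : PolyTime i) : PolyTime fun a => jobsOn (P a) (f a) (i a) := by
  have := filter (l := fun a => MachineActivation.indices (P a)) (p := fun a j => (f a).getD j 0 = i a)
    (by fun_prop) (by fun_prop)
  unfold MachineActivation.jobsOn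
  fun_prop

@[fun_prop]
theorem usedCost {Ms : α → List (ℕ × ℕ × ℕ)} {f : α → List ℕ} (hM : PolyTime Ms)
    (hf : PolyTime f) : PolyTime fun a => usedCost (Ms a) (f a) := by
  unfold MachineActivation.usedCost
  fun_prop

theorem count {l : α → List ℕ} {v : α → ℕ} (hl : PolyTime l) (hv : PolyTime v) :
    PolyTime fun a => (l a).count (v a) := by
  have := filter (p := fun a b => b = v a) hl (by fun_prop)
  have h : PolyTime fun a => ((l a).filter fun b => b = v a).length := by fun_prop
  convert h with a
  rw [← List.countP_eq_length_filter, List.count]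
  rfl

@[fun_prop]
theorem smallVol {P f : α → List ℕ} {c : α → ℕ} (N : ℕ) (hP : PolyTime P) (hf : PolyTime f)
    (hc : PolyTime c) : PolyTime fun a => smallVol N (P a) (c a) (f a) := by
  have := filter (l := fun a => MachineActivation.jobsOn (P a) (f a) 0)
    (p := fun a p => p * N ≤ c a) (by fun_prop) (by fun_prop)
  unfold MachineActivation.smallVol
  fun_prop

@[fun_prop]
theorem key {P f : α → List ℕ} {m c : α → ℕ} (N : ℕ) (hm : PolyTime m) (hP : PolyTime P)
    (hc : PolyTime c) (hf : PolyTime f) : PolyTime fun a => key N (m a) (P a) (c a) (f a) := by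
  have : PolyTime fun x : α × ℕ => (MachineActivation.jobsOn (P x.1) (f x.1) 0).count x.2 :=
    count (by fun_prop) (by fun_prop)
  unfold MachineActivation.key
  fun_prop

@[fun_prop]
theorem expand {P : α → List ℕ} {i c : α → ℕ} {S : α → List (List ℕ)} (N : ℕ) (hP : PolyTime P)
    (hi : PolyTime i) (hc : PolyTime c) (hS : PolyTime S) :
    PolyTime fun a => expand N (P a) (i a) (c a) (S a) := by
  unfold MachineActivation.expand
  fun_prop

theorem sz_set_le {β : Type} [Enc β] (l : List β) (j : ℕ) (b : β) :
    sz (l.set j b) ≤ sz l + sz b := by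
  induction l generalizing j with
  | nil => simp
  | cons a l ih =>
    cases j with
    | zero => simp; omega
    | succ j => have := ih j; simp; omega

@[fun_prop]
theorem fill {P f : α → List ℕ} {i c : α → ℕ} (N : ℕ) (hP : PolyTime P)
    (hi : PolyTime i) (hc : PolyTime c) (hf : PolyTime f) :
    PolyTime fun a => fill N (P a) (i a) (c a) (f a) := by
  unfold MachineActivation.fill
  refine foldl_of_incr (B := fun a => sz (i a)) (by fun_prop) hf (by fun_prop) hi.polyBdd
    fun a s j hj => ?_
  split_ifs
  · exact sz_set_le _ _ _
  · omega

@[fun_prop]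
theorem prune {σ : Type} [Enc σ] {key : α → σ → List ℕ} {cost : α → σ → ℕ} {S : α → List σ}
    (hkey : PolyTime fun x : α × σ => key x.1 x.2)
    (hcost : PolyTime fun x : α × σ => cost x.1 x.2) (hS : PolyTime S) :
    PolyTime fun a => prune (key a) (cost a) (S a) := by
  unfold MachineActivation.prune
  refine foldl_of_incr (B := fun a => sz (S a) + 1) hS (by fun_prop) ?_
    (hS.polyBdd.add (.const 1)) fun a s x hx => ?_
  · have h1 : ∀ {δ : Type} [Enc δ] {g : δ → α} {h : δ → σ}, PolyTime g → PolyTime h →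
        PolyTime fun d => key (g d) (h d) := fun hg hh => comp₂ hkey hg hh
    have h2 : ∀ {δ : Type} [Enc δ] {g : δ → α} {h : δ → σ}, PolyTime g → PolyTime h →
        PolyTime fun d => cost (g d) (h d) := fun hg hh => comp₂ hcost hg hh
    refine ite (.exists_mem (by fun_prop) ?_) (by fun_prop) (cons (by fun_prop)
      (filter (p := fun (x : α × List σ × σ) y => key x.1 y ≠ key x.1 x.2.2) (by fun_prop) ?_))
    · exact ((PolyDec.listEq (h1 (by fun_prop) (by fun_prop)) (h1 (by fun_prop) (by fun_prop))).and
        (.le (h2 (by fun_prop) (by fun_prop)) (h2 (by fun_prop) (by fun_prop))))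
    · exact (PolyDec.listEq (h1 (by fun_prop) (by fun_prop)) (h1 (by fun_prop) (by fun_prop))).not
  · have h1 := sz_le_of_mem hx
    split_ifs
    · omega
    · have := sz_sublist (s.filter_sublist (p := fun y => key a y ≠ key a x))
      rw [sz_cons]; omega

@[fun_prop]
theorem extend {P : α → List ℕ} {Ms : α → List (ℕ × ℕ × ℕ)} {S : α → List (List ℕ)}
    {M : α → ℕ × ℕ × ℕ} (N : ℕ) (hP : PolyTime P) (hMs : PolyTime Ms) (hS : PolyTime S)
    (hM : PolyTime M) : PolyTime fun a => extend N (P a) (Ms a) (S a) (M a) := by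
  have : ∀ k, PolyTime fun a => (MachineActivation.expand N (P a) (M a).1 (M a).2.1)^[k] (S a) := by
    intro k
    induction k with
    | zero => exact hS
    | succ k ih =>
      simp only [Function.iterate_succ_apply']
      fun_prop
  have := this N
  unfold MachineActivation.extend
  fun_prop

end PolyTime

end

/-! ### Partial assignments -/

theorem coe_jobsOn (P f : List ℕ) (i : ℕ) : (jobsOn P f i : Multiset ℕ) =
    ∑ j ∈ Finset.range P.length, if f.getD j 0 = i then {P.getD j 0} else 0 := by
  rw [← Finset.sum_filter]
  simp only [jobsOn, indices, Finset.sum, Finset.filter, Finset.range_val, Multiset.range]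
  rw [Multiset.filter_coe, ← Multiset.map_coe]
  exact (Multiset.sum_map_singleton _).symm.trans (by rw [Multiset.map_map]; rfl)

theorem mem_jobsOn {P f : List ℕ} {i p : ℕ} :
    p ∈ jobsOn P f i ↔ ∃ j < P.length, f.getD j 0 = i ∧ P.getD j 0 = p := by
  simp [jobsOn, and_assoc]

theorem mem_of_mem_jobsOn {P f : List ℕ} {i p : ℕ} (h : p ∈ jobsOn P f i) : p ∈ P := by
  obtain ⟨j, hj, -, rfl⟩ := mem_jobsOn.1 h
  rw [List.getD_eq_getElem _ _ hj]
  exact List.getElem_mem hj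

section

variable {P f : List ℕ} {i j k : ℕ}

theorem getD_set (hj : j < f.length) : (f.set j i).getD k 0 = if k = j then i else f.getD k 0 := by
  rcases eq_or_ne k j with rfl | h
  · simp [List.getD_eq_getElem?_getD, hj]
  · simp [List.getD_eq_getElem?_getD, h, h.symm]

theorem mem_set {x : ℕ} (h : x ∈ f.set j i) : x ∈ f ∨ x = i :=
  List.mem_or_eq_of_mem_set h

theorem coe_jobsOn_set (hj : j < P.length) (hf : f.length = P.length) (k : ℕ) :
    (jobsOn P (f.set j i) k : Multiset ℕ) + (if f.getD j 0 = k then {P.getD j 0} else 0) =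
      (jobsOn P f k : Multiset ℕ) + if i = k then {P.getD j 0} else 0 := by
  have hj' := Finset.mem_range.2 hj
  rw [coe_jobsOn, coe_jobsOn, ← Finset.add_sum_erase _ _ hj', ← Finset.add_sum_erase _ _ hj',
    getD_set (hf ▸ hj), if_pos rfl, Finset.sum_congr rfl (g := fun l =>
      if f.getD l 0 = k then {P.getD l 0} else 0)]
  · abel
  · intro l hl
    rw [getD_set (hf ▸ hj), if_neg (Finset.ne_of_mem_erase hl)]

theorem coe_jobsOn_set_zero (hj : j < P.length) (hf : f.length = P.length) (h0 : f.getD j 0 = 0)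
    (hi : i ≠ 0) :
    P.getD j 0 ::ₘ (jobsOn P (f.set j i) 0 : Multiset ℕ) = (jobsOn P f 0 : Multiset ℕ) := by
  have := coe_jobsOn_set (i := i) hj hf 0
  rw [if_pos h0, if_neg hi, add_zero] at this
  rw [← this, add_comm, Multiset.singleton_add]

theorem sum_jobsOn_set_self (hj : j < P.length) (hf : f.length = P.length) (h0 : f.getD j 0 = 0)
    (hi : i ≠ 0) : (jobsOn P (f.set j i) i).sum = (jobsOn P f i).sum + P.getD j 0 := by
  have := congrArg Multiset.sum (coe_jobsOn_set (i := i) hj hf i)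
  rw [h0, if_neg hi.symm, if_pos rfl] at this
  simpa using this

theorem sum_jobsOn_set_of_ne (hj : j < P.length) (hf : f.length = P.length) (h0 : f.getD j 0 = 0)
    (hk : k ≠ 0) (hki : k ≠ i) : (jobsOn P (f.set j i) k).sum = (jobsOn P f k).sum := by
  have := congrArg Multiset.sum (coe_jobsOn_set (i := i) hj hf k)
  rw [h0, if_neg hk.symm, if_neg hki.symm] at this
  simpa using this

end

/-! ### Pruning -/

section Prune

variable {σ κ : Type} [DecidableEq κ] {key : σ → κ} {cost : σ → ℕ}

theorem prune_append_singleton (S : List σ) (x : σ) :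
    prune key cost (S ++ [x]) =
      if ∃ y ∈ prune key cost S, key y = key x ∧ cost y ≤ cost x then prune key cost S
      else x :: (prune key cost S).filter fun y => key y ≠ key x := by
  rw [prune, List.foldl_append]
  rfl

theorem mem_of_mem_prune {S : List σ} {x : σ} (h : x ∈ prune key cost S) : x ∈ S := by
  induction S using List.reverseRecOn with
  | nil => simp [prune] at h
  | append_singleton S y ih =>
    rw [prune_append_singleton] at h
    split_ifs at h
    · exact List.mem_append_left _ (ih h)
    · rcases List.mem_cons.1 h with rfl | h
      · simp
      · exact List.mem_append_left _ (ih (List.mem_filter.1 h).1)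

theorem exists_mem_prune {S : List σ} {x : σ} (h : x ∈ S) :
    ∃ y ∈ prune key cost S, key y = key x ∧ cost y ≤ cost x := by
  induction S using List.reverseRecOn with
  | nil => simp at h
  | append_singleton S z ih =>
    rw [prune_append_singleton]
    split_ifs with hz
    · rcases List.mem_append.1 h with h | h
      · exact ih h
      · rwa [List.mem_singleton.1 h]
    · rcases List.mem_append.1 h with h | h
      · obtain ⟨y, hy, h1, h2⟩ := ih h
        by_cases hyz : key y = key z
        · refine ⟨z, by simp, hyz ▸ h1, ?_⟩
          by_contra hlt
          exact hz ⟨y, hy, hyz, by omega⟩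
        · exact ⟨y, by simp [hy, hyz], h1, h2⟩
      · exact ⟨z, by simp, by simp [List.mem_singleton.1 h]⟩

theorem nodup_map_prune (S : List σ) : ((prune key cost S).map key).Nodup := by
  induction S using List.reverseRecOn with
  | nil => simp [prune]
  | append_singleton S z ih =>
    rw [prune_append_singleton]
    split_ifs with hz
    · exact ih
    · rw [List.map_cons, List.nodup_cons]
      refine ⟨by simp, ih.sublist (List.Sublist.map _ List.filter_sublist)⟩

end Prune

/-! ### Soundness of the dynamic program -/

/-- `f` assigns jobs only to the machines of the list `L`, within `1 + 2 / N` times their capacity,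
and every job fits by itself on its machine. -/
structure IsPartial (N : ℕ) (P : List ℕ) (L : List (ℕ × ℕ × ℕ)) (f : List ℕ) : Prop where
  length_eq : f.length = P.length
  fits : ∀ j < P.length, f.getD j 0 ≠ 0 → ∃ M ∈ L, M.1 = f.getD j 0 ∧ P.getD j 0 ≤ M.2.1
  load_le : ∀ M ∈ L, (jobsOn P f M.1).sum * N ≤ M.2.1 * (N + 2)

section Sound

variable {N : ℕ} {P f : List ℕ} {L : List (ℕ × ℕ × ℕ)} {M : ℕ × ℕ × ℕ}

theorem IsPartial.jobsOn_eq_nil (h : IsPartial N P L f) {i : ℕ} (hi : i ≠ 0)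
    (hL : i ∉ L.map Prod.fst) : jobsOn P f i = [] := by
  rw [List.eq_nil_iff_forall_not_mem]
  intro p hp
  obtain ⟨j, hj, rfl, -⟩ := mem_jobsOn.1 hp
  obtain ⟨M, hM, h1, -⟩ := h.fits j hj hi
  exact hL (h1 ▸ List.mem_map_of_mem hM)

theorem IsPartial.append (h : IsPartial N P L f) (hM0 : M.1 ≠ 0) (hML : M.1 ∉ L.map Prod.fst) :
    IsPartial N P (L ++ [M]) f := by
  refine ⟨h.length_eq, fun j hj h0 => ?_, fun M' hM' => ?_⟩
  · obtain ⟨M', hM', h1⟩ := h.fits j hj h0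
    exact ⟨M', List.mem_append_left _ hM', h1⟩
  · rcases List.mem_append.1 hM' with hM' | hM'
    · exact h.load_le M' hM'
    · rw [List.mem_singleton.1 hM', h.jobsOn_eq_nil hM0 hML]
      simp

theorem IsPartial.set (h : IsPartial N P (L ++ [M]) f) (hM0 : M.1 ≠ 0)
    (hL : ∀ M' ∈ L, M'.1 ≠ 0) (hML : M.1 ∉ L.map Prod.fst) {j : ℕ} (hj : j < P.length)
    (h0 : f.getD j 0 = 0) (hfit : P.getD j 0 ≤ M.2.1)
    (hload : ((jobsOn P f M.1).sum + P.getD j 0) * N ≤ M.2.1 * (N + 2)) :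
    IsPartial N P (L ++ [M]) (f.set j M.1) := by
  refine ⟨by simp [h.length_eq], fun k hk => ?_, fun M' hM' => ?_⟩
  · rw [getD_set (h.length_eq ▸ hj)]
    split_ifs with hkj
    · exact fun _ => ⟨M, by simp, rfl, hkj ▸ hfit⟩
    · exact h.fits k hk
  · rcases List.mem_append.1 hM' with hM'' | hM''
    · rw [sum_jobsOn_set_of_ne hj h.length_eq h0 (hL M' hM'')
        fun he => hML (List.mem_map.2 ⟨M', hM'', he⟩)]
      exact h.load_le M' hM'
    · rw [List.mem_singleton.1 hM'', sum_jobsOn_set_self hj h.length_eq h0 hM0]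
      exact hload

theorem mem_expand {i c : ℕ} {S : List (List ℕ)} {f : List ℕ} :
    f ∈ expand N P i c S ↔ f ∈ S ∨ ∃ g ∈ S, ∃ j < P.length, (g.getD j 0 = 0 ∧
      c < P.getD j 0 * N ∧ (jobsOn P g i).sum + P.getD j 0 ≤ c) ∧ f = g.set j i := by
  simp only [expand, List.mem_append, List.mem_flatMap, mem_indices]
  refine or_congr_right (exists_congr fun g => and_congr_right fun _ => exists_congr fun j =>
    and_congr_right fun _ => ?_)
  split_ifs with h
  · rw [List.mem_singleton, and_iff_right h]
  · simp only [List.not_mem_nil, h, false_and]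

theorem IsPartial.iterate_expand (hM0 : M.1 ≠ 0) (hL : ∀ M' ∈ L, M'.1 ≠ 0)
    (hML : M.1 ∉ L.map Prod.fst) (k : ℕ) {S : List (List ℕ)}
    (hS : ∀ f ∈ S, IsPartial N P (L ++ [M]) f) :
    ∀ f ∈ (expand N P M.1 M.2.1)^[k] S, IsPartial N P (L ++ [M]) f := by
  induction k with
  | zero => exact hS
  | succ k ih =>
    intro f hf
    rw [Function.iterate_succ_apply', mem_expand] at hf
    rcases hf with hf | ⟨g, hg, j, hj, ⟨h0, -, h2⟩, rfl⟩
    · exact ih f hf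
    · refine (ih g hg).set hM0 hL hML hj h0 (by omega) ?_
      calc _ ≤ M.2.1 * N := Nat.mul_le_mul_right _ h2
        _ ≤ _ := Nat.mul_le_mul_left _ (by omega)

theorem IsPartial.fill (hN : 0 < N) (hM0 : M.1 ≠ 0) (hL : ∀ M' ∈ L, M'.1 ≠ 0)
    (hML : M.1 ∉ L.map Prod.fst) (hf : IsPartial N P (L ++ [M]) f) :
    IsPartial N P (L ++ [M]) (fill N P M.1 M.2.1 f) := by
  unfold MachineActivation.fill
  refine List.foldlRecOn _ _ hf fun g hg j hj => ?_
  split_ifs with h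
  · obtain ⟨h0, h1, h2⟩ := h
    refine hg.set hM0 hL hML (mem_indices.1 hj) h0 ((Nat.le_mul_of_pos_right _ hN).trans h1) ?_
    nlinarith
  · exact hg

theorem IsPartial.extend (hN : 0 < N) (hM0 : M.1 ≠ 0) (hL : ∀ M' ∈ L, M'.1 ≠ 0)
    (hML : M.1 ∉ L.map Prod.fst) {S : List (List ℕ)} (hS : ∀ f ∈ S, IsPartial N P L f)
    (Ms : List (ℕ × ℕ × ℕ)) : ∀ f ∈ extend N P Ms S M, IsPartial N P (L ++ [M]) f := by
  intro f hf
  have hS' : ∀ f ∈ S, IsPartial N P (L ++ [M]) f := fun f hf => (hS f hf).append hM0 hML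
  rcases List.mem_append.1 (mem_of_mem_prune hf) with hf | hf
  · exact hS' f hf
  · obtain ⟨g, hg, rfl⟩ := List.mem_map.1 hf
    exact (IsPartial.iterate_expand hM0 hL hML N hS' g hg).fill hN hM0 hL hML

theorem isPartial_init (N : ℕ) (P : List ℕ) : IsPartial N P [] (P.map fun _ => 0) := by
  refine ⟨by simp, fun j hj h => ?_, by simp⟩
  simp [List.getD_eq_getElem?_getD, hj] at h

/-- Every partial assignment produced by the dynamic program respects the capacities up to the
factor `1 + 2 / N`. -/
theorem isPartial_of_mem_foldl (hN : 0 < N) {Ms L : List (ℕ × ℕ × ℕ)} (h0 : ∀ M ∈ L, M.1 ≠ 0)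
    (hnd : (L.map Prod.fst).Nodup) :
    ∀ f ∈ L.foldl (MachineActivation.extend N P Ms) [P.map fun _ => 0], IsPartial N P L f := by
  induction L using List.reverseRecOn with
  | nil =>
    intro f hf
    rw [List.mem_singleton.1 hf]
    exact isPartial_init N P
  | append_singleton L M ih =>
    rw [List.map_append, List.nodup_append] at hnd
    rw [List.foldl_append]
    refine IsPartial.extend hN (h0 M (by simp)) (fun M' h => h0 M' (by simp [h])) (fun h => ?_)
      (ih (fun M' h => h0 M' (by simp [h])) hnd.1) Ms
    exact hnd.2.2 _ h M.1 (by simp) rfl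

end Sound

/-! ### Completeness of the dynamic program -/

/-- The multiset `A` of remaining jobs is, at capacity `c`, as good as `B` up to the error `e`: both
have the same large jobs, and the volume of the small jobs of `A` exceeds that of `B` by at most
`e / k`. -/
def Dominates (N k c e : ℕ) (A B : Multiset ℕ) : Prop :=
  A.filter (fun p => c < p * N) = B.filter (fun p => c < p * N) ∧
    (A.filter fun p => p * N ≤ c).sum * k ≤ (B.filter fun p => p * N ≤ c).sum * k + e

section

variable {N : ℕ} {P f : List ℕ}

theorem sum_filter_add_sum_filter (A : Multiset ℕ) (N c : ℕ) :
    (A.filter fun p => p * N ≤ c).sum + (A.filter fun p => c < p * N).sum = A.sum := by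
  conv_rhs => rw [← Multiset.filter_add_not (fun p => p * N ≤ c) A]
  simp

theorem sum_filter_eq_add {c c' : ℕ} (h : c ≤ c') (A : Multiset ℕ) :
    (A.filter fun p => p * N ≤ c').sum = (A.filter fun p => p * N ≤ c).sum +
      ((A.filter fun p => c < p * N).filter fun p => p * N ≤ c').sum := by
  rw [← Multiset.sum_add, ← Multiset.filter_add_not (fun p => p * N ≤ c)
    (A.filter fun p => p * N ≤ c'), Multiset.filter_filter, Multiset.filter_filter,
    Multiset.filter_filter]
  congr 2
  · exact Multiset.filter_congr fun p _ => by omega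
  · exact Multiset.filter_congr fun p _ => by omega

/-- Passing to a larger capacity turns some of the large jobs, on which both sides agree, into small
ones. -/
theorem Dominates.mono {k c c' e e' : ℕ} {A B : Multiset ℕ} (h : Dominates N k c e A B)
    (hc : c ≤ c') (he : e ≤ e') : Dominates N k c' e' A B := by
  obtain ⟨h1, h2⟩ := h
  constructor
  · have key : ∀ A : Multiset ℕ, A.filter (fun p => c' < p * N) =
        (A.filter fun p => c < p * N).filter fun p => c' < p * N := fun A => by
      rw [Multiset.filter_filter]
      exact Multiset.filter_congr fun p _ => by omega
    rw [key A, key B, h1]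
  · rw [sum_filter_eq_add hc A, sum_filter_eq_add hc B, h1, add_mul, add_mul]
    omega

/-- Partial assignments with equal keys dominate each other with the error `c`. -/
theorem Dominates.of_key {m c e : ℕ} {f g : List ℕ} {B : Multiset ℕ}
    (hN : 0 < N) (h : key N m P c f = key N m P c g) (hg : Dominates N (N * m) c e (jobsOn P g 0) B) :
    Dominates N (N * m) c (e + c) (jobsOn P f 0) B := by
  obtain ⟨h1, h2⟩ := List.cons.inj h
  refine ⟨?_, ?_⟩
  · rw [← hg.1]
    ext v
    rw [Multiset.count_filter, Multiset.count_filter]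
    split_ifs with hv
    · by_cases hvP : v ∈ P
      · have := List.map_inj_left.1 h2 v hvP
        simpa [hv] using this
      · rw [Multiset.coe_count, Multiset.coe_count,
          List.count_eq_zero_of_not_mem fun h => hvP (mem_of_mem_jobsOn h),
          List.count_eq_zero_of_not_mem fun h => hvP (mem_of_mem_jobsOn h)]
    · rfl
  · have h3 := hg.2
    simp only [Multiset.filter_coe, Multiset.sum_coe] at h3 ⊢
    change smallVol N P c g * (N * m) ≤ _ at h3
    change smallVol N P c f * (N * m) ≤ _
    rcases Nat.eq_zero_or_pos c with rfl | hc
    -- for `c = 0` the quotient in the key is always `0`, but then only jobs of size `0` are small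
    · have key : ∀ f, smallVol N P 0 f * (N * m) = 0 := fun f => by
        rw [smallVol, List.sum_eq_zero fun p hp => ?_, zero_mul]
        simpa [hN.ne'] using (List.mem_filter.1 hp).2
      rw [key]
      omega
    · have h4 := Nat.div_mul_le_self (smallVol N P c f * (N * m) + (c - 1)) c
      have h5 := Nat.lt_div_mul_add (a := smallVol N P c g * (N * m) + (c - 1)) hc
      have h6 := Nat.lt_div_mul_add (a := smallVol N P c f * (N * m) + (c - 1)) hc
      have h7 := Nat.div_mul_le_self (smallVol N P c g * (N * m) + (c - 1)) c
      rw [h1] at h4 h6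
      omega

theorem jobsOn_eq_nil_of_key {m c : ℕ} {f g : List ℕ} (hN : 0 < N) (hm : 0 < m)
    (hP : ∀ p ∈ P, 0 < p) (h : key N m P c f = key N m P c g) (hg : jobsOn P g 0 = []) :
    jobsOn P f 0 = [] := by
  obtain ⟨h1, h2⟩ := List.cons.inj h
  have hs : smallVol N P c f = 0 := by
    have h0 : smallVol N P c g = 0 := by simp [smallVol, hg]
    rcases Nat.eq_zero_or_pos c with rfl | hc
    · refine List.sum_eq_zero fun p hp => ?_
      have := (List.mem_filter.1 hp).2
      simpa [hN.ne'] using this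
    · rw [h0, zero_mul, zero_add, Nat.div_eq_of_lt (by omega : c - 1 < c),
        Nat.div_eq_zero_iff_lt hc] at h1
      by_contra hne
      have : 0 < smallVol N P c f * (N * m) := by positivity
      omega
  rw [List.eq_nil_iff_forall_not_mem]
  intro p hp
  have hpP := mem_of_mem_jobsOn hp
  by_cases hpc : c < p * N
  · have := List.map_inj_left.1 h2 p hpP
    simp only [hpc, if_true, hg, List.count_nil] at this
    exact List.count_eq_zero.1 this hp
  · have : p ≤ smallVol N P c f :=
      List.single_le_sum (by simp) _ (List.mem_filter.2 ⟨hp, by simpa using hpc⟩)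
    have := hP p hpP
    omega

theorem usedCost_le {Ms : List (ℕ × ℕ × ℕ)} (hnd : (Ms.map Prod.fst).Nodup) {M : ℕ × ℕ × ℕ}
    (hM : M ∈ Ms) {f g : List ℕ} (h : ∀ x ∈ g, x ∈ f ∨ x = M.1) :
    usedCost Ms g ≤ usedCost Ms f + M.2.2 := by
  have key : ∀ L : List (ℕ × ℕ × ℕ), (L.map Prod.fst).Nodup → (∀ M' ∈ L, M' ∈ Ms) →
      usedCost L g ≤ usedCost L f + if M ∈ L then M.2.2 else 0 := by
    intro L
    induction L with
    | nil => simp [usedCost]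
    | cons K L ih =>
      intro h1 h2
      rw [List.map_cons, List.nodup_cons] at h1
      have h3 := ih h1.2 fun M' h => h2 M' (List.mem_cons_of_mem _ h)
      simp only [usedCost, List.map_cons, List.sum_cons] at h3 ⊢
      by_cases hMK : M = K
      · subst hMK
        have : M ∉ L := fun h => h1.1 (List.mem_map_of_mem h)
        simp only [this, if_false, List.mem_cons_self, if_true] at h3 ⊢
        split_ifs <;> omega
      · have hK : K.1 ∈ g → K.1 ∈ f := fun hK => (h _ hK).resolve_right fun he =>
          hMK (List.inj_on_of_nodup_map hnd (h2 K List.mem_cons_self) hM he).symm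
        have : (if K.1 ∈ g then K.2.2 else 0) ≤ if K.1 ∈ f then K.2.2 else 0 := by
          split_ifs <;> simp_all
        simp only [List.mem_cons, hMK, false_or]
        omega
  simpa [hM] using key Ms hnd fun _ h => h

theorem subset_iterate_expand (i c k : ℕ) {S : List (List ℕ)} (h : f ∈ S) :
    f ∈ (expand N P i c)^[k] S := by
  induction k with
  | zero => exact h
  | succ k ih =>
    rw [Function.iterate_succ_apply', mem_expand]
    exact .inl ih

/-- Every multiset of large jobs that fits on machine `i` can be placed there, one job at a time. -/
theorem exists_mem_iterate_expand {i c : ℕ} (hi : i ≠ 0) (D : Multiset ℕ) :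
    ∀ (k : ℕ) (S : List (List ℕ)) (f : List ℕ), f ∈ S → f.length = P.length →
      (∀ v ∈ D, c < v * N) → D ≤ jobsOn P f 0 → (jobsOn P f i).sum + D.sum ≤ c → D.card ≤ k →
      ∃ g ∈ (expand N P i c)^[k] S, g.length = P.length ∧
        (jobsOn P f 0 : Multiset ℕ) = jobsOn P g 0 + D ∧
        (jobsOn P g i).sum = (jobsOn P f i).sum + D.sum ∧ ∀ x ∈ g, x ∈ f ∨ x = i := by
  induction D using Multiset.induction with
  | empty =>
    intro k S f hf hlen _ _ _ _
    exact ⟨f, subset_iterate_expand i c k hf, hlen, by simp, by simp, fun x hx => .inl hx⟩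
  | cons v D ih =>
    intro k S f hf hlen hD hle hsum hcard
    have hv : v ∈ jobsOn P f 0 := Multiset.mem_coe.1 (Multiset.mem_of_le hle (by simp))
    obtain ⟨j, hj, h0, rfl⟩ := mem_jobsOn.1 hv
    rw [Multiset.sum_cons] at hsum
    rw [Multiset.card_cons] at hcard
    obtain ⟨k, rfl⟩ : ∃ k', k = k' + 1 := ⟨k - 1, by omega⟩
    have hset := coe_jobsOn_set_zero hj hlen h0 hi
    have hself := sum_jobsOn_set_self hj hlen h0 hi
    obtain ⟨g, hg, h1, h2, h3, h4⟩ := ih k (expand N P i c S) (f.set j i)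
      (mem_expand.2 (.inr ⟨f, hf, j, hj, ⟨h0, hD _ (by simp), by omega⟩, rfl⟩)) (by simp [hlen])
      (fun w hw => hD w (Multiset.mem_cons_of_mem hw))
      (by rw [← hset] at hle; exact (Multiset.cons_le_cons_iff _).1 hle) (by omega) (by omega)
    refine ⟨g, by rwa [Function.iterate_succ_apply], h1, ?_, ?_, fun x hx => ?_⟩
    · rw [← hset, h2, Multiset.add_cons]
    · rw [h3, hself, Multiset.sum_cons]; omega
    · rcases h4 x hx with h | h
      · exact mem_set h
      · exact .inr h

/-- Filling a machine up leaves the large jobs alone and moves small jobs to the machine, until there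
are none left or the load is at least `(1 + 1 / N) * c`. -/
theorem fill_spec {i c : ℕ} (hi : i ≠ 0) (hlen : f.length = P.length) :
    (∀ x ∈ fill N P i c f, x ∈ f ∨ x = i) ∧
    (jobsOn P (fill N P i c f) 0 : Multiset ℕ).filter (fun p => c < p * N) =
      (jobsOn P f 0 : Multiset ℕ).filter (fun p => c < p * N) ∧
    (jobsOn P (fill N P i c f) i).sum + smallVol N P c (fill N P i c f) =
      (jobsOn P f i).sum + smallVol N P c f ∧
    ((jobsOn P (fill N P i c f) 0 : Multiset ℕ).filter (fun p => p * N ≤ c) = 0 ∨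
      c * (N + 1) ≤ (jobsOn P (fill N P i c f) i).sum * N) := by
  let step := fun (f : List ℕ) (j : ℕ) =>
    if f.getD j 0 = 0 ∧ P.getD j 0 * N ≤ c ∧ (jobsOn P f i).sum * N < c * (N + 1) then f.set j i
    else f
  have key : ∀ (l : List ℕ) (f : List ℕ), f.length = P.length → (∀ j ∈ l, j < P.length) →
      (∀ x ∈ l.foldl step f, x ∈ f ∨ x = i) ∧
      (jobsOn P (l.foldl step f) 0 : Multiset ℕ).filter (fun p => c < p * N) =
        (jobsOn P f 0 : Multiset ℕ).filter (fun p => c < p * N) ∧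
      (jobsOn P (l.foldl step f) i).sum + smallVol N P c (l.foldl step f) =
        (jobsOn P f i).sum + smallVol N P c f ∧
      (jobsOn P f i).sum ≤ (jobsOn P (l.foldl step f) i).sum ∧
      (∀ j, f.getD j 0 ≠ 0 → (l.foldl step f).getD j 0 ≠ 0) ∧
      ((∀ j ∈ l, P.getD j 0 * N ≤ c → (l.foldl step f).getD j 0 ≠ 0) ∨
        c * (N + 1) ≤ (jobsOn P (l.foldl step f) i).sum * N) := by
    intro l
    induction l with
    | nil => intro f _ _; simp +contextual
    | cons j l ih =>
      intro f hlen hl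
      have hj := hl j List.mem_cons_self
      have hl' : ∀ j ∈ l, j < P.length := fun j h => hl j (List.mem_cons_of_mem _ h)
      rw [List.foldl_cons]
      by_cases h : f.getD j 0 = 0 ∧ P.getD j 0 * N ≤ c ∧ (jobsOn P f i).sum * N < c * (N + 1)
      · have hs : step f j = f.set j i := if_pos h
        rw [hs]
        obtain ⟨h0, hsmall, -⟩ := h
        obtain ⟨h1, h2, h3, h4, h5, h6⟩ := ih (f.set j i) (by simp [hlen]) hl'
        have hset := coe_jobsOn_set_zero hj hlen h0 hi
        have hself := sum_jobsOn_set_self hj hlen h0 hi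
        refine ⟨fun x hx => ?_, ?_, ?_, by omega, fun k hk => h5 k ?_, ?_⟩
        · rcases h1 x hx with h | h
          · exact mem_set h
          · exact .inr h
        · rw [h2, ← hset, Multiset.filter_cons_of_neg _ (by omega)]
        · rw [h3, hself]
          have : smallVol N P c f = P.getD j 0 + smallVol N P c (f.set j i) := by
            have := congrArg (fun A => (Multiset.filter (fun p => p * N ≤ c) A).sum) hset
            rw [Multiset.filter_cons_of_pos (p := fun p => p * N ≤ c) _ hsmall] at this
            simpa [smallVol] using this.symm
          omega
        · rw [getD_set (hlen ▸ hj)]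
          split_ifs
          · exact hi
          · exact hk
        · refine h6.imp_left fun h6 k hk hkc => ?_
          rcases List.mem_cons.1 hk with rfl | hk
          · refine h5 k ?_
            rw [getD_set (hlen ▸ hj), if_pos rfl]
            exact hi
          · exact h6 k hk hkc
      · have hs : step f j = f := if_neg h
        rw [hs]
        obtain ⟨h1, h2, h3, h4, h5, h6⟩ := ih f hlen hl'
        refine ⟨h1, h2, h3, h4, h5, ?_⟩
        by_cases hload : (jobsOn P f i).sum * N < c * (N + 1)
        · refine h6.imp_left fun h6 k hk hkc => ?_
          rcases List.mem_cons.1 hk with rfl | hk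
          · exact h5 k fun h0 => h ⟨h0, hkc, hload⟩
          · exact h6 k hk hkc
        · exact .inr ((not_lt.1 hload).trans (Nat.mul_le_mul_right _ h4))
  obtain ⟨h1, h2, h3, -, -, h6⟩ := key (indices P) f hlen (by simp)
  refine ⟨h1, h2, h3, h6.imp_left fun h6 => ?_⟩
  rw [Multiset.filter_eq_nil]
  intro p hp hpc
  obtain ⟨j, hj, h0, rfl⟩ := mem_jobsOn.1 (Multiset.mem_coe.1 hp)
  exact h6 j (by simpa using hj) hpc h0

/-- A set of large jobs that fits on a machine has at most `N` elements. -/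
theorem card_large_le {c : ℕ} {D : Multiset ℕ} (hD : ∀ v ∈ D, c < v * N) (hsum : D.sum ≤ c) :
    D.card ≤ N := by
  have h1 : D.card • (c + 1) ≤ (D.map (· * N)).sum := by
    rw [← Multiset.card_map (· * N) D]
    refine Multiset.card_nsmul_le_sum fun v hv => ?_
    obtain ⟨w, hw, rfl⟩ := Multiset.mem_map.1 hv
    exact hD w hw
  rw [Multiset.sum_map_mul_right, Multiset.map_id', smul_eq_mul] at h1
  have h2 : D.sum * N ≤ c * N := Nat.mul_le_mul_right _ hsum
  by_contra h
  have h3 : (N + 1) * (c + 1) ≤ D.card * (c + 1) := Nat.mul_le_mul_right _ (by omega)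
  nlinarith

/-- If a machine of capacity `c` takes over the jobs `J` in the given schedule, then a dominating
partial assignment can be extended to this machine so that it dominates again, and without error:
the extra space on the machine makes up for an error of at most `c / N`. -/
theorem exists_extension {i c m e : ℕ} (hN : 0 < N) (hi : i ≠ 0) (hm : 0 < m) (he : e ≤ m * c)
    {S : List (List ℕ)} (hf : f ∈ S) (hlen : f.length = P.length) (hfi : jobsOn P f i = [])
    {R J : Multiset ℕ} (hdom : Dominates N (N * m) c e (jobsOn P f 0) (R + J)) (hJ : J.sum ≤ c)
    (hP : ∀ p ∈ P, 0 < p) :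
    ∃ g ∈ ((expand N P i c)^[N] S).map (fill N P i c), (∀ x ∈ g, x ∈ f ∨ x = i) ∧
      Dominates N (N * m) c 0 (jobsOn P g 0) R ∧ (R = 0 → jobsOn P g 0 = []) := by
  have hlarge : ∀ v ∈ J.filter fun p => c < p * N, c < v * N := fun v hv =>
    (Multiset.mem_filter.1 hv).2
  have hJs := sum_filter_add_sum_filter J N c
  obtain ⟨h1, h2⟩ := hdom
  rw [Multiset.filter_add] at h1
  rw [Multiset.filter_add, Multiset.sum_add] at h2
  obtain ⟨g, hg, hglen, hg0, hgi, hgx⟩ := exists_mem_iterate_expand hi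
    (J.filter fun p => c < p * N) N S f hf hlen hlarge
    (le_trans (h1 ▸ Multiset.le_add_left _ _) (Multiset.filter_le _ _))
    (by rw [hfi, List.sum_nil]; omega) (card_large_le hlarge (by omega))
  obtain ⟨h3, h4, h5, h6⟩ := fill_spec (N := N) (c := c) hi hglen
  have hl : (jobsOn P (fill N P i c g) 0 : Multiset ℕ).filter (fun p => c < p * N) =
      R.filter fun p => c < p * N := by
    rw [h4]
    rw [hg0, Multiset.filter_add, Multiset.filter_filter] at h1
    simpa using h1
  have hsv : smallVol N P c f = smallVol N P c g := by
    have := congrArg (fun A => (Multiset.filter (fun p => p * N ≤ c) A).sum) hg0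
    simp only [Multiset.filter_add, Multiset.sum_add, Multiset.filter_filter] at this
    rw [Multiset.filter_eq_nil.2 (fun p _ => by omega :
      ∀ p ∈ J, ¬ (p * N ≤ c ∧ c < p * N))] at this
    simpa [smallVol] using this
  rw [hfi, List.sum_nil, zero_add] at hgi
  have hs : ∀ f, ((jobsOn P f 0 : Multiset ℕ).filter fun p => p * N ≤ c).sum = smallVol N P c f :=
    fun f => by simp [smallVol]
  rw [hs] at h2
  -- if the load reached `c + c / N`, then the small jobs on the machine have at least the volume of
  -- those in `J` plus `c / N`
  have hvol : smallVol N P c (fill N P i c g) * N ≤ (R.filter fun p => p * N ≤ c).sum * N := by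
    rcases h6 with h6 | h6
    · rw [← hs, h6]
      simp
    · have h7 : smallVol N P c f * N ≤
          ((R.filter fun p => p * N ≤ c).sum + (J.filter fun p => p * N ≤ c).sum) * N + c := by
        refine Nat.le_of_mul_le_mul_right ?_ hm
        rw [add_mul _ c m, mul_assoc, mul_assoc, mul_comm c m]
        omega
      have h8 := congrArg (· * N) h5
      have h9 := Nat.mul_le_mul_right N hJ
      rw [← hJs] at h9
      simp only [add_mul, hgi, ← hsv, mul_add, mul_one] at h6 h7 h8 h9
      omega
  refine ⟨_, List.mem_map_of_mem hg, fun x hx => ?_, ⟨hl, ?_⟩, ?_⟩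
  · rcases h3 x hx with h | h
    · exact hgx x h
    · exact .inr h
  · rw [hs, ← mul_assoc, ← mul_assoc]
    exact Nat.mul_le_mul_right m hvol
  · rintro rfl
    rw [List.eq_nil_iff_forall_not_mem]
    intro p hp
    have hp0 := hP p (mem_of_mem_jobsOn hp)
    by_cases hpc : c < p * N
    · have : p ∈ (jobsOn P (fill N P i c g) 0 : Multiset ℕ).filter (fun p => c < p * N) :=
        Multiset.mem_filter.2 ⟨hp, hpc⟩
      rw [hl] at this
      simp at this
    · have h7 : p ≤ smallVol N P c (fill N P i c g) :=
        List.single_le_sum (by simp) _ (List.mem_filter.2 ⟨hp, by simpa using hpc⟩)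
      have h8 : 0 < smallVol N P c (fill N P i c g) * N := Nat.mul_pos (by omega) hN
      simp at hvol
      omega

theorem jobsOn_init (P : List ℕ) : jobsOn P (P.map fun _ => 0) 0 = P := by
  have : (indices P).filter (fun j => decide ((P.map fun _ => 0).getD j 0 = 0)) = indices P := by
    rw [List.filter_eq_self]
    intro j hj
    simp [List.getD_eq_getElem?_getD, mem_indices.1 hj]
  rw [jobsOn, this]
  refine List.ext_getElem (by simp [indices]) fun j h1 h2 => ?_
  simp [indices, h2]

/-- Along a given schedule `g` within the capacities, the dynamic program keeps a partial assignment
that dominates the part of `g` concerning the machines considered so far, and is no more expensive.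
The error is at most `c / (N * m)` for each of them, `m` being the number of machines. -/
theorem exists_mem_foldl_extend {Ms : List (ℕ × ℕ × ℕ)} {g : List ℕ} (hN : 0 < N)
    (hP : ∀ p ∈ P, 0 < p) (h0 : ∀ M ∈ Ms, M.1 ≠ 0) (hnd : (Ms.map Prod.fst).Nodup)
    (hsort : Ms.Pairwise fun M M' => M.2.1 ≤ M'.2.1)
    (hload : ∀ M ∈ Ms, (jobsOn P g M.1).sum ≤ M.2.1)
    (hall : (P : Multiset ℕ) = (Ms.map fun M => (jobsOn P g M.1 : Multiset ℕ)).sum)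
    (L L' : List (ℕ × ℕ × ℕ)) (hL : Ms = L ++ L') :
    ∀ c, (∀ M ∈ L, M.2.1 ≤ c) → ∃ f ∈ L.foldl (extend N P Ms) [P.map fun _ => 0],
      Dominates N (N * Ms.length) c (L.length * c) (jobsOn P f 0)
        (L'.map fun M => (jobsOn P g M.1 : Multiset ℕ)).sum ∧
      usedCost Ms f ≤ usedCost L g ∧
      ((L'.map fun M => (jobsOn P g M.1 : Multiset ℕ)).sum = 0 → jobsOn P f 0 = []) := by
  induction L using List.reverseRecOn generalizing L' with
  | nil =>
    intro c _
    have hL' : Ms = L' := hL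
    subst hL'
    refine ⟨P.map fun _ => 0, by simp, ?_, ?_, ?_⟩
    · rw [jobsOn_init, ← hall]
      exact ⟨rfl, by omega⟩
    · simp only [usedCost, List.map_nil, List.sum_nil, nonpos_iff_eq_zero]
      refine List.sum_eq_zero fun x hx => ?_
      obtain ⟨M, hM, rfl⟩ := List.mem_map.1 hx
      rw [if_neg]
      intro h
      obtain ⟨_, -, h⟩ := List.mem_map.1 h
      exact h0 M hM h.symm
    · rw [jobsOn_init, ← hall]
      simp
  | append_singleton L M ih =>
    have hMs : Ms = L ++ (M :: L') := by simp [hL]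
    have hMM : M ∈ Ms := by simp [hL]
    have hm : 0 < Ms.length := List.length_pos_of_mem hMM
    have hLm : L.length + 1 ≤ Ms.length := by simp [hMs]
    have hcap : ∀ M' ∈ L, M'.2.1 ≤ M.2.1 := fun M' hM' => by
      rw [hMs] at hsort
      exact (List.pairwise_append.1 hsort).2.2 M' hM' M (by simp)
    have hML : M.1 ∉ L.map Prod.fst := fun h => by
      rw [hMs, List.map_append, List.nodup_append] at hnd
      exact hnd.2.2 _ h M.1 (by simp) rfl
    have hndL : (L.map Prod.fst).Nodup := by
      rw [hMs, List.map_append, List.nodup_append] at hnd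
      exact hnd.1
    obtain ⟨f, hf, hdom, hcost, hnil⟩ := ih (M :: L') hMs M.2.1 hcap
    have hpart := isPartial_of_mem_foldl hN (fun M' h => h0 M' (by simp [hMs, h])) hndL f hf
    rw [List.map_cons, List.sum_cons] at hdom hnil
    have hgcost : usedCost (L ++ [M]) g = usedCost L g + if M.1 ∈ g then M.2.2 else 0 := by
      simp [usedCost]
    rw [List.foldl_append, List.foldl_cons, List.foldl_nil]
    -- before pruning, there is a suitable partial assignment with the error of the previous step
    obtain ⟨h, hh, hdom', hcost', hnil'⟩ :
        ∃ h ∈ L.foldl (extend N P Ms) [P.map fun _ => 0] ++ ((expand N P M.1 M.2.1)^[N]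
          (L.foldl (extend N P Ms) [P.map fun _ => 0])).map (fill N P M.1 M.2.1),
        Dominates N (N * Ms.length) M.2.1 (L.length * M.2.1) (jobsOn P h 0)
          (L'.map fun M => (jobsOn P g M.1 : Multiset ℕ)).sum ∧
        usedCost Ms h ≤ usedCost (L ++ [M]) g ∧
        ((L'.map fun M => (jobsOn P g M.1 : Multiset ℕ)).sum = 0 → jobsOn P h 0 = []) := by
      by_cases hMg : M.1 ∈ g
      · obtain ⟨h, hh, hx, hdom', hnil'⟩ := exists_extension hN (h0 M hMM) hm
          (Nat.mul_le_mul_right M.2.1 (by omega : L.length ≤ Ms.length)) hf hpart.length_eq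
          (hpart.jobsOn_eq_nil (h0 M hMM) hML) (add_comm (jobsOn P g M.1 : Multiset ℕ) _ ▸ hdom)
          (by simpa using hload M hMM) hP
        refine ⟨h, List.mem_append_right _ hh, hdom'.mono le_rfl (Nat.zero_le _), ?_, hnil'⟩
        have := usedCost_le hnd hMM hx
        rw [hgcost, if_pos hMg]
        omega
      · have hJ : jobsOn P g M.1 = [] := by
          rw [List.eq_nil_iff_forall_not_mem]
          intro p hp
          obtain ⟨j, hj, h1, -⟩ := mem_jobsOn.1 hp
          by_cases hjg : j < g.length
          · rw [List.getD_eq_getElem _ _ hjg] at h1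
            exact hMg (h1 ▸ List.getElem_mem hjg)
          · rw [List.getD_eq_default _ _ (by omega)] at h1
            exact h0 M hMM h1.symm
        rw [hJ, Multiset.coe_nil, zero_add] at hdom hnil
        exact ⟨f, List.mem_append_left _ hf, hdom, by rw [hgcost]; omega, hnil⟩
    intro c hc
    obtain ⟨f', hf', hkey, hle⟩ := exists_mem_prune (key := key N Ms.length P M.2.1)
      (cost := usedCost Ms) hh
    have hMc := hc M (by simp)
    refine ⟨f', hf', (hdom'.of_key hN hkey).mono hMc ?_, hle.trans hcost', fun h =>
      jobsOn_eq_nil_of_key hN hm hP hkey (hnil' h)⟩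
    rw [List.length_append, List.length_singleton, add_mul, one_mul]
    exact Nat.add_le_add (Nat.mul_le_mul_left _ hMc) hMc

theorem exists_mem_solutions {Ms : List (ℕ × ℕ × ℕ)} {g : List ℕ} (hN : 0 < N)
    (hP : ∀ p ∈ P, 0 < p) (h0 : ∀ M ∈ Ms, M.1 ≠ 0) (hnd : (Ms.map Prod.fst).Nodup)
    (hsort : Ms.Pairwise fun M M' => M.2.1 ≤ M'.2.1)
    (hload : ∀ M ∈ Ms, (jobsOn P g M.1).sum ≤ M.2.1)
    (hall : (P : Multiset ℕ) = (Ms.map fun M => (jobsOn P g M.1 : Multiset ℕ)).sum) :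
    ∃ f ∈ solutions N P Ms, jobsOn P f 0 = [] ∧ usedCost Ms f ≤ usedCost Ms g := by
  obtain ⟨f, hf, -, h1, h2⟩ := exists_mem_foldl_extend hN hP h0 hnd hsort hload hall Ms [] (by simp)
    (Ms.map fun M => M.2.1).sum fun M hM =>
      List.single_le_sum (by simp) _ (List.mem_map_of_mem hM)
  exact ⟨f, hf, h2 (by simp), h1⟩

end

/-! ### The number of partial assignments -/

section

variable {N : ℕ} {P f : List ℕ}

theorem count_jobsOn (P f : List ℕ) (i p : ℕ) :
    (jobsOn P f i).count p = (indices P).countP fun j => P.getD j 0 = p ∧ f.getD j 0 = i := by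
  rw [jobsOn, List.count, List.countP_map, List.countP_filter]
  refine List.countP_congr fun j _ => ?_
  simp

/-- Jobs larger than all capacities considered so far are unassigned. -/
theorem IsPartial.count_eq {L : List (ℕ × ℕ × ℕ)} {c p : ℕ} (h : IsPartial N P L f)
    (hc : ∀ M ∈ L, M.2.1 ≤ c) (hp : c < p) : (jobsOn P f 0).count p = P.count p := by
  conv_rhs => rw [← jobsOn_init P]
  rw [count_jobsOn, count_jobsOn]
  refine List.countP_congr fun j hj => ?_
  have hj' := mem_indices.1 hj
  have h1 : (P.map fun _ => 0).getD j 0 = 0 := by simp [List.getD_eq_getElem?_getD, hj']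
  simp only [decide_eq_true_eq, h1, and_true, and_iff_left_iff_imp]
  rintro rfl
  by_contra h0
  obtain ⟨M, hM, -, h2⟩ := h.fits j hj' h0
  have := hc M hM
  omega

/-- A set that contains all numbers `q * 2 ^ e` with `q < 2 * N` that are large for `c` and at most
`c`. -/
def window (N c : ℕ) : Finset ℕ :=
  ((Finset.range (2 * N)) ×ˢ (Finset.range (2 * N ^ 2))).image fun x => x.1 * 2 ^ (Nat.log 2 c - x.2)

theorem card_window_le (N c : ℕ) : (window N c).card ≤ 4 * N ^ 3 := by
  refine Finset.card_image_le.trans (le_of_eq ?_)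
  rw [Finset.card_product, Finset.card_range, Finset.card_range]
  ring

theorem mem_window {c q e : ℕ} (hq : q < 2 * N) (h1 : c < q * 2 ^ e * N) (h2 : q * 2 ^ e ≤ c) :
    q * 2 ^ e ∈ window N c := by
  have hq0 : 0 < q := by
    rcases Nat.eq_zero_or_pos q with rfl | h
    · simp at h1
    · exact h
  have hc : c ≠ 0 := by
    have : 0 < q * 2 ^ e := by positivity
    omega
  have he : e ≤ Nat.log 2 c :=
    Nat.le_log_of_pow_le (by norm_num) ((Nat.le_mul_of_pos_left _ hq0).trans h2)
  obtain ⟨d, hd⟩ := Nat.exists_eq_add_of_le he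
  refine Finset.mem_image.2 ⟨(q, d), ?_, by simp [hd]⟩
  refine Finset.mem_product.2 ⟨Finset.mem_range.2 hq, Finset.mem_range.2 ?_⟩
  have h3 : 2 ^ e * 2 ^ d ≤ c := by
    rw [← pow_add, ← hd]
    exact Nat.pow_log_le_self 2 hc
  have h4 : 2 ^ e * 2 ^ d < 2 ^ e * (2 * N ^ 2) := by
    calc 2 ^ e * 2 ^ d ≤ c := h3
      _ < q * (2 ^ e * N) := by rw [← mul_assoc]; exact h1
      _ ≤ (2 * N) * (2 ^ e * N) := Nat.mul_le_mul_right _ hq.le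
      _ = _ := by ring
  exact Nat.lt_two_pow_self.trans (Nat.lt_of_mul_lt_mul_left h4)

/-- If the job sizes have short mantissas, then there are only polynomially many keys. -/
theorem length_le_of_nodup_key {L : List (ℕ × ℕ × ℕ)} {c m : ℕ} {S : List (List ℕ)}
    (hP : ∀ p ∈ P, ∃ q < 2 * N, ∃ e, p = q * 2 ^ e) (hc : ∀ M ∈ L, M.2.1 ≤ c)
    (hS : ∀ f ∈ S, IsPartial N P L f) (hnd : (S.map (key N m P c)).Nodup) :
    S.length ≤ (P.length * m + 2) * (P.length + 1) ^ (4 * N ^ 3) := by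
  -- the counts in the window determine the key: larger sizes are still complete
  let decode : ℕ × (window N c → ℕ) → List ℕ := fun x => x.1 :: P.map fun p =>
    if c < p * N then if h : p ∈ window N c then x.2 ⟨p, h⟩ else P.count p else 0
  let T := ((Finset.range (P.length * m + 2)) ×ˢ
    (Fintype.piFinset fun _ : window N c => Finset.range (P.length + 1))).image decode
  have hsub : (S.map (key N m P c)).toFinset ⊆ T := by
    intro k hk
    obtain ⟨f, hf, rfl⟩ := List.mem_map.1 (List.mem_toFinset.1 hk)
    have hlen : (jobsOn P f 0).length ≤ P.length := by
      rw [jobsOn, List.length_map]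
      exact (List.length_filter_le _ _).trans (by simp [indices])
    refine Finset.mem_image.2 ⟨((smallVol N P c f * (N * m) + (c - 1)) / c,
      fun v => (jobsOn P f 0).count v.1), Finset.mem_product.2 ⟨?_, ?_⟩, ?_⟩
    · rw [Finset.mem_range]
      rcases Nat.eq_zero_or_pos c with rfl | hc0
      · simp
      · rw [Nat.div_lt_iff_lt_mul hc0]
        have h1 : smallVol N P c f * N ≤ P.length * c := by
          have h2 : (((jobsOn P f 0).filter fun p => p * N ≤ c).map (· * N)).sum ≤
              (((jobsOn P f 0).filter fun p => p * N ≤ c).map (· * N)).length • c := by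
            refine List.sum_le_card_nsmul _ _ fun x hx => ?_
            obtain ⟨p, hp, rfl⟩ := List.mem_map.1 hx
            simpa using (List.mem_filter.1 hp).2
          rw [List.sum_map_mul_right, List.map_id', List.length_map, smul_eq_mul] at h2
          exact h2.trans (Nat.mul_le_mul_right _ ((List.length_filter_le _ _).trans hlen))
        have h2 := Nat.mul_le_mul_right m h1
        have h3 : P.length * c * m = P.length * m * c := by ring
        rw [← mul_assoc, add_mul]
        omega
    · rw [Fintype.mem_piFinset]
      intro v
      rw [Finset.mem_range]
      exact Nat.lt_succ_of_le (List.count_le_length.trans hlen)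
    · simp only [decode, key]
      congr 1
      refine List.map_congr_left fun p hp => ?_
      split_ifs with h1 h2
      · rfl
      · obtain ⟨q, hq, e, rfl⟩ := hP p hp
        refine ((hS f hf).count_eq hc ?_).symm
        by_contra h3
        exact h2 (mem_window hq h1 (by omega))
      · rfl
  have h1 : S.length = (S.map (key N m P c)).toFinset.card := by
    rw [List.toFinset_card_of_nodup hnd, List.length_map]
  rw [h1]
  refine (Finset.card_le_card hsub).trans (Finset.card_image_le.trans ?_)
  rw [Finset.card_product, Finset.card_range, Fintype.card_piFinset]
  simp only [Finset.card_range, Finset.prod_const, Finset.card_univ, Fintype.card_coe]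
  exact Nat.mul_le_mul_left _ (Nat.pow_le_pow_right (by omega) (card_window_le N c))

theorem IsPartial.sz_le {L Ms : List (ℕ × ℕ × ℕ)} (h : IsPartial N P L f)
    (hL : ∀ M ∈ L, M ∈ Ms) : sz f ≤ P.length * (sz Ms + 1) + 1 := by
  rw [← h.length_eq]
  refine sz_le_of_forall fun x hx => ?_
  obtain ⟨j, hj, rfl⟩ := List.getElem_of_mem hx
  rcases Nat.eq_zero_or_pos f[j] with h0 | h0
  · rw [h0]
    exact sz_pos Ms
  · have h1 : f.getD j 0 = f[j] := List.getD_eq_getElem _ _ hj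
    obtain ⟨M, hM, h2, -⟩ := h.fits j (h.length_eq ▸ hj) (by omega)
    rw [← h1, ← h2]
    have h3 := sz_le_of_mem (hL M hM)
    rw [sz_prod M] at h3
    omega

end

theorem PolyTime.solutions {α : Type} [Enc α] {N : ℕ} {P : α → List ℕ}
    {Ms : α → List (ℕ × ℕ × ℕ)} (hP : PolyTime P) (hMs : PolyTime Ms) (hN : 0 < N)
    (h0 : ∀ a, ∀ M ∈ Ms a, M.1 ≠ 0) (hnd : ∀ a, ((Ms a).map Prod.fst).Nodup)
    (hsort : ∀ a, (Ms a).Pairwise fun M M' => M.2.1 ≤ M'.2.1)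
    (hPr : ∀ a, ∀ p ∈ P a, ∃ q < 2 * N, ∃ e, p = q * 2 ^ e) :
    PolyTime fun a => solutions N (P a) (Ms a) := by
  have hb : PolyBdd fun a => sz (P a) := hP.polyBdd
  have hb' : PolyBdd fun a => sz (Ms a) := hMs.polyBdd
  have hlen : PolyBdd fun a => (P a).length := hb.mono fun a => length_le_sz _
  have hlen' : PolyBdd fun a => (Ms a).length := hb'.mono fun a => length_le_sz _
  unfold MachineActivation.solutions
  refine foldl_of_bdd (B := fun a => (((P a).length * (Ms a).length + 2) *
    ((P a).length + 1) ^ (4 * N ^ 3)) * ((P a).length * (sz (Ms a) + 1) + 1 + 1) + 1) hMs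
    (by fun_prop) (by fun_prop) ?_ fun a L L' hL => ?_
  · exact ((((hlen.mul hlen').add (.const 2)).mul ((hlen.add (.const 1)).pow _)).mul
      (((hlen.mul (hb'.add (.const 1))).add (.const 1)).add (.const 1))).add (.const 1)
  · have hmem : ∀ M ∈ L, M ∈ Ms a := fun M hM => by rw [hL]; exact List.mem_append_left _ hM
    have hndL : (L.map Prod.fst).Nodup := by
      have := hnd a
      rw [hL, List.map_append, List.nodup_append] at this
      exact this.1
    have hpart := isPartial_of_mem_foldl (P := P a) hN (fun M h => h0 a M (hmem M h)) hndL (Ms := Ms a)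
    refine (sz_le_of_forall fun f hf => (hpart f hf).sz_le hmem).trans ?_
    refine Nat.add_le_add_right (Nat.mul_le_mul_right _ ?_) _
    rcases List.eq_nil_or_concat L with rfl | ⟨L, M, rfl⟩
    · exact Nat.mul_pos (by omega) (by positivity)
    · rw [List.concat_eq_append] at *
      refine length_le_of_nodup_key (hPr a) (c := M.2.1) (fun M' hM' => ?_) hpart ?_
      · rcases List.mem_append.1 hM' with hM' | hM'
        · have := hsort a
          rw [hL, List.append_assoc] at this
          exact (List.pairwise_append.1 this).2.2 M' hM' M (by simp)
        · rw [List.mem_singleton.1 hM']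
      · rw [List.foldl_append]
        exact nodup_map_prune _

/-! ### Rounding and sorting -/

/-- `p`, rounded down to a multiple of a power of two so that the quotient is less than `2 * N`. If
`p < N`, then the power is `1`, since `Nat.log 2 0 = 0`. -/
def roundDown (N p : ℕ) : ℕ := p / 2 ^ Nat.log 2 (p / N) * 2 ^ Nat.log 2 (p / N)

theorem roundDown_le (N p : ℕ) : roundDown N p ≤ p := Nat.div_mul_le_self _ _

section

variable {N p : ℕ}

theorem mul_two_pow_log_le (hN : 0 < N) (hp : N ≤ p) : N * 2 ^ Nat.log 2 (p / N) ≤ p := by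
  have h1 := Nat.pow_log_le_self 2 (Nat.div_pos hp hN).ne'
  calc N * 2 ^ Nat.log 2 (p / N) ≤ N * (p / N) := Nat.mul_le_mul_left _ h1
    _ ≤ p := Nat.mul_div_le p N

theorem roundDown_eq_self (hp : p < N) : roundDown N p = p := by
  simp [roundDown, Nat.div_eq_of_lt hp]

theorem roundDown_pos (hN : 0 < N) (hp : 0 < p) : 0 < roundDown N p := by
  rcases lt_or_ge p N with h | h
  · rwa [roundDown_eq_self h]
  · have h1 := mul_two_pow_log_le hN h
    exact Nat.mul_pos (Nat.div_pos ((Nat.le_mul_of_pos_left _ hN).trans h1) (by positivity))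
      (by positivity)

theorem mul_le_roundDown_mul (hN : 0 < N) : p * N ≤ roundDown N p * (N + 1) := by
  rcases lt_or_ge p N with h | h
  · rw [roundDown_eq_self h]
    exact Nat.mul_le_mul_left _ (by omega)
  · have h1 := mul_two_pow_log_le hN h
    have h2 := Nat.lt_div_mul_add (a := p) (b := 2 ^ Nat.log 2 (p / N)) (by positivity)
    have h3 : N ≤ p / 2 ^ Nat.log 2 (p / N) := by rwa [Nat.le_div_iff_mul_le (by positivity)]
    unfold roundDown
    nlinarith [Nat.mul_le_mul_right (2 ^ Nat.log 2 (p / N)) h3]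

theorem exists_roundDown_eq (hN : 0 < N) (p : ℕ) :
    ∃ q < 2 * N, ∃ e, roundDown N p = q * 2 ^ e := by
  refine ⟨_, ?_, _, rfl⟩
  rw [Nat.div_lt_iff_lt_mul (by positivity)]
  have h1 := Nat.lt_pow_succ_log_self (b := 2) (by norm_num) (p / N)
  rw [Nat.div_lt_iff_lt_mul hN] at h1
  calc p < _ := h1
    _ = _ := by rw [pow_succ]; ring

end

/-- The machines in the order of their capacities. -/
def sortMachines (Ms : List (ℕ × ℕ × ℕ)) : List (ℕ × ℕ × ℕ) :=
  Ms.foldl (fun L M => (L.filter fun K => K.2.1 ≤ M.2.1) ++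
    M :: L.filter fun K => ¬ K.2.1 ≤ M.2.1) []

theorem sortMachines_perm (Ms : List (ℕ × ℕ × ℕ)) : (sortMachines Ms).Perm Ms := by
  induction Ms using List.reverseRecOn with
  | nil => exact List.Perm.refl _
  | append_singleton Ms M ih =>
    rw [sortMachines, List.foldl_append, ← sortMachines]
    refine List.perm_middle.trans ((List.Perm.cons M ?_).trans (List.perm_append_singleton _ _).symm)
    have := List.filter_append_perm (fun K : ℕ × ℕ × ℕ => decide (K.2.1 ≤ M.2.1)) (sortMachines Ms)
    simp only [decide_not]
    exact this.trans ih

theorem pairwise_sortMachines (Ms : List (ℕ × ℕ × ℕ)) :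
    (sortMachines Ms).Pairwise fun M M' => M.2.1 ≤ M'.2.1 := by
  induction Ms using List.reverseRecOn with
  | nil => exact List.Pairwise.nil
  | append_singleton Ms M ih =>
    rw [sortMachines, List.foldl_append]
    refine List.pairwise_append.2 ⟨ih.sublist List.filter_sublist,
      List.pairwise_cons.2 ⟨fun K hK => ?_, ih.sublist List.filter_sublist⟩, fun K hK K' hK' => ?_⟩
    · have := (List.mem_filter.1 hK).2
      simp at this
      omega
    · have h1 := (List.mem_filter.1 hK).2
      rcases List.mem_cons.1 hK' with rfl | hK'
      · simpa using h1
      · have h2 := (List.mem_filter.1 hK').2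
        simp at h1 h2
        omega

/-! ### Schedules for a given makespan bound -/

/-- The machines with their numbers, capacities and activation costs, if the machine with speed `s`
has the capacity `s * x`. The list `ml` consists of the speeds and activation costs. -/
def machineList (ml : List (ℕ × ℕ)) (x : ℕ) : List (ℕ × ℕ × ℕ) :=
  (indices ml).map fun i => (i + 1, (ml.getD i (0, 0)).1 * x, (ml.getD i (0, 0)).2)

/-- The total assignments found by the dynamic program for the makespan bound `x / y`, where `pl` is
the list of the job sizes. -/
def assignments (N : ℕ) (pl : List ℕ) (ml : List (ℕ × ℕ)) (x y : ℕ) : List (List ℕ) :=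
  (solutions N (pl.map fun p => roundDown N (p * y)) (sortMachines (machineList ml x))).filter
    fun f => 0 ∉ f

section

variable {α : Type} [Enc α]

theorem sz_perm {β : Type} [Enc β] {l l' : List β} (h : l.Perm l') : sz l = sz l' := by
  induction h with
  | nil => rfl
  | cons a _ ih => simp [ih]
  | swap a b l => simp; omega
  | trans _ _ h1 h2 => exact h1.trans h2

namespace PolyTime

theorem two_pow_log {f : α → ℕ} (hf : PolyTime f) : PolyTime fun a => 2 ^ Nat.log 2 (f a) := by
  have hit : ∀ (i x : ℕ), (fun z : ℕ × ℕ => (z.1 / 2, z.2 * 2))^[i] (x, 1) = (x / 2 ^ i, 2 ^ i) := by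
    intro i x
    induction i with
    | zero => simp
    | succ i ih =>
      rw [Function.iterate_succ_apply', ih, Nat.div_div_eq_div_mul, ← pow_succ]
  have hlog : ∀ x, Nat.log 2 x ≤ sz x := fun x => by
    rcases Nat.eq_zero_or_pos x with rfl | hx
    · simp
    · rw [sz_nat]
      have := Nat.lt_size.2 (Nat.pow_log_le_self 2 hx.ne')
      omega
  have := iterate (c := fun z : ℕ × ℕ => 2 ≤ z.1) (g := fun z => (z.1 / 2, z.2 * 2))
    (init := fun x : ℕ => (x, 1)) (k := fun x => Nat.log 2 x)
    (B := fun x => sz x + (sz x + 2) + 1) (by fun_prop) (by fun_prop)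
    (by fun_prop) (PolyBdd.sz.mono hlog) ((PolyBdd.sz.add (PolyBdd.sz.add (.const 2))).add (.const 1))
    (fun x i hi => ?_) (fun x i hi => ?_) (fun x => ?_)
  · have h2 : PolyTime fun x : ℕ =>
      ((fun z : ℕ × ℕ => (z.1 / 2, z.2 * 2))^[Nat.log 2 x] (x, 1)).2 := snd.comp this
    simp only [hit] at h2
    exact h2.comp hf
  · rw [hit, sz_pair, sz_nat, sz_nat, sz_nat, Nat.size_pow]
    have h1 := Nat.size_le_size (Nat.div_le_self x (2 ^ i))
    have h2 := hlog x
    rw [sz_nat] at h2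
    omega
  · rw [hit]
    change 2 ≤ x / 2 ^ i
    have hx : x ≠ 0 := by
      rintro rfl
      simp at hi
    rw [Nat.le_div_iff_mul_le (by positivity)]
    calc 2 * 2 ^ i = 2 ^ (i + 1) := by ring
      _ ≤ 2 ^ Nat.log 2 x := Nat.pow_le_pow_right (by norm_num) hi
      _ ≤ x := Nat.pow_log_le_self 2 hx
  · rw [hit]
    change ¬ 2 ≤ x / 2 ^ Nat.log 2 x
    rw [not_le, Nat.div_lt_iff_lt_mul (by positivity), mul_comm, ← pow_succ]
    exact Nat.lt_pow_succ_log_self (by norm_num) x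

@[fun_prop]
theorem roundDown {f : α → ℕ} (N : ℕ) (hf : PolyTime f) : PolyTime fun a => roundDown N (f a) := by
  have := two_pow_log (f := fun a => f a / N) (by fun_prop)
  unfold MachineActivation.roundDown
  fun_prop

@[fun_prop]
theorem sortMachines {f : α → List (ℕ × ℕ × ℕ)} (hf : PolyTime f) :
    PolyTime fun a => sortMachines (f a) := by
  unfold MachineActivation.sortMachines
  refine foldl_of_incr (B := fun a => sz (f a) + 1) hf (by fun_prop) ?_ (hf.polyBdd.add (.const 1))
    fun a L M hM => ?_
  · have h1 := filter (l := fun x : α × List (ℕ × ℕ × ℕ) × (ℕ × ℕ × ℕ) => x.2.1)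
      (p := fun x K => K.2.1 ≤ x.2.2.2.1) (by fun_prop) (by fun_prop)
    have h2 := filter (l := fun x : α × List (ℕ × ℕ × ℕ) × (ℕ × ℕ × ℕ) => x.2.1)
      (p := fun x K => ¬ K.2.1 ≤ x.2.2.2.1) (by fun_prop) (by fun_prop)
    fun_prop
  · have h1 := sz_le_of_mem hM
    have h2 := List.filter_append_perm (fun K : ℕ × ℕ × ℕ => decide (K.2.1 ≤ M.2.1)) L
    simp only [decide_not]
    rw [sz_perm (List.perm_middle.trans (List.Perm.cons M h2)), sz_cons]
    omega

@[fun_prop]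
theorem machineList {ml : α → List (ℕ × ℕ)} {x : α → ℕ} (hm : PolyTime ml) (hx : PolyTime x) :
    PolyTime fun a => machineList (ml a) (x a) := by
  unfold MachineActivation.machineList
  fun_prop

end PolyTime

theorem map_fst_machineList (ml : List (ℕ × ℕ)) (x : ℕ) :
    (machineList ml x).map Prod.fst = (indices ml).map (· + 1) := by
  simp [machineList, Function.comp_def]

theorem nodup_sortMachines (ml : List (ℕ × ℕ)) (x : ℕ) :
    ((sortMachines (machineList ml x)).map Prod.fst).Nodup := by
  rw [((sortMachines_perm _).map _).nodup_iff, map_fst_machineList]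
  exact List.Nodup.map (add_left_injective 1) List.nodup_range

theorem ne_zero_of_mem_sortMachines {ml : List (ℕ × ℕ)} {x : ℕ} {M : ℕ × ℕ × ℕ}
    (h : M ∈ sortMachines (machineList ml x)) : M.1 ≠ 0 := by
  obtain ⟨i, -, rfl⟩ := List.mem_map.1 ((sortMachines_perm _).mem_iff.1 h)
  simp

@[fun_prop]
theorem PolyTime.assignments {N : ℕ} [NeZero N] {pl : α → List ℕ} {ml : α → List (ℕ × ℕ)}
    {x y : α → ℕ} (hp : PolyTime pl) (hm : PolyTime ml) (hx : PolyTime x) (hy : PolyTime y) :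
    PolyTime fun a => assignments N (pl a) (ml a) (x a) (y a) := by
  have hN : 0 < N := Nat.pos_of_neZero N
  unfold MachineActivation.assignments
  refine PolyTime.filter (p := fun _ f => 0 ∉ f) ?_ (by fun_prop)
  refine PolyTime.solutions (by fun_prop) (by fun_prop) hN (fun a M => ne_zero_of_mem_sortMachines)
    (fun a => nodup_sortMachines _ _) (fun a => pairwise_sortMachines _) fun a p h => ?_
  obtain ⟨q, -, rfl⟩ := List.mem_map.1 h
  exact exists_roundDown_eq hN _

end

/-! ### Schedules and total assignments -/

theorem sum_jobsOn (P f : List ℕ) (i : ℕ) :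
    (jobsOn P f i).sum = ∑ j ∈ Finset.range P.length, if f.getD j 0 = i then P.getD j 0 else 0 := by
  have := congrArg Multiset.sumAddMonoidHom (coe_jobsOn P f i)
  rw [map_sum] at this
  simpa [apply_ite Multiset.sum] using this

theorem usedCost_sortMachines (ml : List (ℕ × ℕ)) (x : ℕ) (f : List ℕ) :
    usedCost (sortMachines (machineList ml x)) f =
      ∑ i ∈ Finset.range ml.length, if i + 1 ∈ f then (ml.getD i (0, 0)).2 else 0 := by
  rw [usedCost, ((sortMachines_perm _).map _).sum_eq, machineList, List.map_map, indices]
  rfl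

theorem mem_sortMachines {ml : List (ℕ × ℕ)} {x : ℕ} {M : ℕ × ℕ × ℕ} :
    M ∈ sortMachines (machineList ml x) ↔
      ∃ i < ml.length, (i + 1, (ml.getD i (0, 0)).1 * x, (ml.getD i (0, 0)).2) = M := by
  rw [(sortMachines_perm _).mem_iff, machineList, List.mem_map]
  simp only [mem_indices]

/-- The lists `pl` and `ml` contain the data of the instance `I`, multiplied by `D`. -/
structure IsScaled (I : RelatedInstance) (D : ℕ) (pl : List ℕ) (ml : List (ℕ × ℕ)) : Prop where
  pos : 0 < D
  length_pl : pl.length = I.n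
  length_ml : ml.length = I.m
  size_eq : ∀ j : Fin I.n, ((pl.getD j 0 : ℕ) : ℚ≥0) = D * I.p j
  speed_eq : ∀ i : Fin I.m, (((ml.getD i (0, 0)).1 : ℕ) : ℚ≥0) = D * I.s i
  cost_eq : ∀ i : Fin I.m, (((ml.getD i (0, 0)).2 : ℕ) : ℚ≥0) = D * I.a i

/-- The schedule described by a total assignment: the list of the indicators of the used machines,
and the list of the machines assigned to the jobs, which are now numbered from `0` on. -/
def toOutput (ml : List (ℕ × ℕ)) (f : List ℕ) : List ℕ × List ℕ :=
  ((indices ml).map fun i => if i + 1 ∈ f then 1 else 0, f.map fun i => i - 1)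

section

variable {I : RelatedInstance} {D N : ℕ} {pl f : List ℕ} {ml : List (ℕ × ℕ)} {x y : ℕ}

theorem getD_map_roundDown (pl : List ℕ) (N y j : ℕ) :
    (pl.map fun p => roundDown N (p * y)).getD j 0 = roundDown N (pl.getD j 0 * y) := by
  have : roundDown N 0 = 0 := by simp [roundDown]
  by_cases h : j < pl.length <;> simp [List.getD_eq_getElem?_getD, h, this]

theorem exists_schedule_of_mem_assignments (h : IsScaled I D pl ml) (hN : 0 < N) (hy : 0 < y)
    (hf : f ∈ assignments N pl ml x y) :
    ∃ τ : Schedule I, τ.encode = enc (toOutput ml f) ∧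
      D * τ.cost = usedCost (sortMachines (machineList ml x)) f ∧
      τ.makespan ≤ (1 + 1 / N) * (1 + 2 / N) * (x / y) := by
  obtain ⟨hsol, hf0⟩ := List.mem_filter.1 hf
  have hpart := isPartial_of_mem_foldl hN (fun M => ne_zero_of_mem_sortMachines (ml := ml))
    (nodup_sortMachines ml x) f hsol
  have hlen : f.length = I.n := by rw [hpart.length_eq, List.length_map, h.length_pl]
  simp only [decide_eq_true_eq] at hf0
  have hmem : ∀ j : Fin I.n, f.getD j 0 ∈ f := fun j => by
    rw [List.getD_eq_getElem _ _ (j.2.trans_eq hlen.symm)]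
    exact List.getElem_mem _
  have hmach : ∀ j : Fin I.n, ∃ i : Fin I.m, f.getD j 0 = i + 1 := fun j => by
    obtain ⟨M, hM, h1, -⟩ := hpart.fits j (by rw [List.length_map, h.length_pl]; exact j.2)
      fun h0 => hf0 (h0 ▸ hmem j)
    obtain ⟨i, hi, rfl⟩ := mem_sortMachines.1 hM
    exact ⟨⟨i, h.length_ml ▸ hi⟩, h1.symm⟩
  choose assign hassign using hmach
  let τ : Schedule I :=
    { active := Finset.univ.filter fun i => (i : ℕ) + 1 ∈ f
      assign := assign
      assign_mem := fun j => by simpa [← hassign j] using hmem j }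
  refine ⟨τ, ?_, ?_, ?_⟩
  · have h1 : (List.ofFn fun i => Val.num (if i ∈ τ.active then 1 else 0)) =
        (((indices ml).map fun i => if i + 1 ∈ f then 1 else 0).map enc) := by
      refine List.ext_getElem (by simp [indices, h.length_ml]) fun i h1 h2 => ?_
      simp [indices, τ, enc]
    have h2 : (List.ofFn fun j => Val.num (τ.assign j : ℕ)) =
        ((f.map fun i => i - 1).map enc) := by
      refine List.ext_getElem (by simp [hlen]) fun j h1 h2 => ?_
      have hj : j < I.n := by simpa using h1
      have := hassign ⟨j, hj⟩
      rw [List.getD_eq_getElem _ _ (hj.trans_eq hlen.symm)] at this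
      simp only [List.getElem_ofFn, List.getElem_map, this]
      rfl
    rw [Schedule.encode, h1, h2]
    rfl
  · rw [usedCost_sortMachines, h.length_ml, Finset.sum_range, Schedule.cost, Finset.mul_sum]
    push_cast
    rw [Finset.sum_filter]
    refine Finset.sum_congr rfl fun i _ => ?_
    split_ifs
    · exact (h.cost_eq i).symm
    · rfl
  · refine Finset.sup_le fun i _ => ?_
    have hs : 0 < I.s i := I.s_pos i
    have hD : (0 : ℚ≥0) < D := by exact_mod_cast h.pos
    have hload := hpart.load_le _ (mem_sortMachines.2 ⟨i, i.2.trans_eq h.length_ml.symm, rfl⟩)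
    rw [sum_jobsOn, List.length_map, h.length_pl, Finset.sum_range] at hload
    simp only [getD_map_roundDown] at hload
    -- in terms of the true sizes
    have hload' : (∑ j : Fin I.n, if f.getD j 0 = i + 1 then pl.getD j 0 * y else 0) * (N * N) ≤
        (ml.getD i (0, 0)).1 * x * ((N + 1) * (N + 2)) := by
      have h1 : (∑ j : Fin I.n, if f.getD j 0 = i + 1 then pl.getD j 0 * y else 0) * N ≤
          (∑ j : Fin I.n, if f.getD j 0 = i + 1 then roundDown N (pl.getD j 0 * y) else 0) *
            (N + 1) := by
        rw [Finset.sum_mul, Finset.sum_mul]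
        refine Finset.sum_le_sum fun j _ => ?_
        split_ifs
        · exact mul_le_roundDown_mul hN
        · simp
      have h2 := Nat.mul_le_mul_right N h1
      have h3 := Nat.mul_le_mul_right (N + 1) hload
      calc _ = _ := (mul_assoc _ _ _).symm
        _ ≤ _ := h2
        _ = _ := by ring
        _ ≤ _ := h3
        _ = _ := by ring
    have hload'' : (τ.load i * I.s i * D * y) * (N * N) ≤ D * I.s i * x * ((N + 1) * (N + 2)) := by
      have h1 : τ.load i * I.s i * D * y =
          ∑ j : Fin I.n, if f.getD j 0 = i + 1 then ((pl.getD j 0 : ℕ) : ℚ≥0) * y else 0 := by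
        rw [Schedule.load, Finset.sum_mul, Finset.sum_mul, Finset.sum_mul, Finset.sum_filter]
        refine Finset.sum_congr rfl fun j _ => ?_
        have h2 : τ.assign j = i ↔ f.getD j 0 = i + 1 := by
          rw [hassign j]
          simp [τ, Fin.ext_iff]
        simp only [h2]
        split_ifs
        · rw [h.size_eq, div_mul_cancel₀ _ hs.ne']
          ring
        · rfl
      rw [h1, ← h.speed_eq]
      exact_mod_cast hload'
    have hy' : (0 : ℚ≥0) < y := by exact_mod_cast hy
    have hN' : (0 : ℚ≥0) < N := by exact_mod_cast hN
    have h4 : τ.load i ≤ D * I.s i * x * ((N + 1) * (N + 2)) / (I.s i * D * y * (N * N)) := by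
      rw [le_div_iff₀ (by positivity)]
      refine le_trans (le_of_eq (by ring)) hload''
    refine h4.trans (le_of_eq ?_)
    field_simp

theorem exists_mem_assignments (h : IsScaled I D pl ml) (hN : 0 < N) (hy : 0 < y) (σ : Schedule I)
    (hσ : σ.makespan ≤ x / y) : ∃ f ∈ assignments N pl ml x y,
      (usedCost (sortMachines (machineList ml x)) f : ℚ≥0) ≤ D * σ.cost := by
  set P := pl.map fun p => roundDown N (p * y) with hPdef
  have hPlen : P.length = I.n := by simp [P, h.length_pl]
  have hD : (0 : ℚ≥0) < D := by exact_mod_cast h.pos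
  have hy' : (0 : ℚ≥0) < y := by exact_mod_cast hy
  let g : List ℕ := List.ofFn fun j => (σ.assign j : ℕ) + 1
  have hg : ∀ j : Fin I.n, g.getD j 0 = σ.assign j + 1 := fun j => by
    simp [g, List.getD_eq_getElem?_getD]
  have hP : ∀ p ∈ P, 0 < p := by
    intro p hp
    obtain ⟨q, hq, rfl⟩ := List.mem_map.1 hp
    obtain ⟨j, hj, rfl⟩ := List.getElem_of_mem hq
    refine roundDown_pos hN (Nat.mul_pos ?_ hy)
    have h1 := h.size_eq ⟨j, h.length_pl ▸ hj⟩
    rw [List.getD_eq_getElem _ _ hj] at h1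
    have h2 : (0 : ℚ≥0) < (pl[j] : ℕ) := by
      rw [h1]
      exact mul_pos hD (I.p_pos _)
    exact_mod_cast h2
  have hload : ∀ M ∈ sortMachines (machineList ml x), (jobsOn P g M.1).sum ≤ M.2.1 := by
    intro M hM
    obtain ⟨i, hi, rfl⟩ := mem_sortMachines.1 hM
    rw [h.length_ml] at hi
    have hs : 0 < I.s ⟨i, hi⟩ := I.s_pos _
    have h1 : σ.load ⟨i, hi⟩ ≤ x / y := (Finset.le_sup (Finset.mem_univ _)).trans hσ
    have h2 : (∑ j : Fin I.n, if g.getD j 0 = i + 1 then ((pl.getD j 0 : ℕ) : ℚ≥0) * y else 0) =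
        σ.load ⟨i, hi⟩ * (I.s ⟨i, hi⟩ * D * y) := by
      rw [Schedule.load, Finset.sum_mul, Finset.sum_filter]
      refine Finset.sum_congr rfl fun j _ => ?_
      have h2 : σ.assign j = ⟨i, hi⟩ ↔ g.getD j 0 = i + 1 := by
        rw [hg j]
        simp [Fin.ext_iff]
      simp only [h2]
      split_ifs
      · rw [h.size_eq, ← mul_assoc, ← mul_assoc, div_mul_cancel₀ _ hs.ne']
        ring
      · rfl
    have h3 : (∑ j : Fin I.n, if g.getD j 0 = i + 1 then ((pl.getD j 0 : ℕ) : ℚ≥0) * y else 0) ≤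
        ((ml.getD i (0, 0)).1 : ℕ) * (x : ℚ≥0) := by
      rw [h2, h.speed_eq ⟨i, hi⟩]
      refine (mul_le_mul_of_nonneg_right h1 (by positivity)).trans (le_of_eq ?_)
      field_simp
    have h4 : (∑ j : Fin I.n, if g.getD j 0 = i + 1 then pl.getD j 0 * y else 0) ≤
        (ml.getD i (0, 0)).1 * x := by exact_mod_cast h3
    rw [sum_jobsOn, hPlen, Finset.sum_range]
    refine le_trans (Finset.sum_le_sum fun j _ => ?_) h4
    simp only [hPdef, getD_map_roundDown]
    split_ifs
    · exact roundDown_le _ _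
    · exact le_rfl
  have hall : (P : Multiset ℕ) = ((sortMachines (machineList ml x)).map fun M =>
      (jobsOn P g M.1 : Multiset ℕ)).sum := by
    rw [((sortMachines_perm _).map _).sum_eq, machineList, List.map_map]
    change _ = ∑ i ∈ Finset.range ml.length, (jobsOn P g (i + 1) : Multiset ℕ)
    conv_lhs => rw [← jobsOn_init P]
    simp only [coe_jobsOn]
    rw [Finset.sum_comm]
    refine Finset.sum_congr rfl fun j hj => ?_
    have hj' := Finset.mem_range.1 hj
    have h1 : (P.map fun _ => 0).getD j 0 = 0 := by simp [List.getD_eq_getElem?_getD, hj']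
    have h2 := hg ⟨j, hPlen ▸ hj'⟩
    simp only at h2
    simp only [h1, if_true, h2, Nat.add_right_cancel_iff]
    rw [Finset.sum_ite_eq, if_pos]
    rw [Finset.mem_range, h.length_ml]
    exact (σ.assign _).2
  obtain ⟨f, hf, hf0, hcost⟩ := exists_mem_solutions hN hP
    (fun M => ne_zero_of_mem_sortMachines (ml := ml)) (nodup_sortMachines ml x)
    (pairwise_sortMachines _) hload hall
  refine ⟨f, List.mem_filter.2 ⟨hf, ?_⟩, ?_⟩
  · have hpart := isPartial_of_mem_foldl hN (fun M => ne_zero_of_mem_sortMachines (ml := ml))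
      (nodup_sortMachines ml x) f hf
    simp only [decide_eq_true_eq]
    intro h0
    obtain ⟨j, hj, h1⟩ := List.getElem_of_mem h0
    have : P.getD j 0 ∈ jobsOn P f 0 := mem_jobsOn.2 ⟨j, hpart.length_eq ▸ hj,
      by rw [List.getD_eq_getElem _ _ hj, h1], rfl⟩
    simp [hf0] at this
  · refine le_trans (Nat.cast_le.2 hcost) ?_
    rw [usedCost_sortMachines, h.length_ml, Finset.sum_range, Schedule.cost, Finset.mul_sum]
    push_cast
    rw [← Finset.sum_filter]
    refine le_trans (le_of_eq (Finset.sum_congr rfl fun i _ => h.cost_eq i))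
      (Finset.sum_le_sum_of_subset fun i hi => ?_)
    have h1 := (Finset.mem_filter.1 hi).2
    obtain ⟨j, hj⟩ := (List.mem_ofFn' _ _).1 h1
    have h2 : σ.assign j = i := by
      simp only [Nat.add_right_cancel_iff] at hj
      exact Fin.ext hj
    exact h2 ▸ σ.assign_mem j

end

/-! ### Instances with integral data -/

/-- The data of an instance and of a bound, rational numbers being pairs of natural numbers. -/
abbrev RawInput : Type := (List (ℕ × ℕ) × List ((ℕ × ℕ) × (ℕ × ℕ))) × (ℕ × ℕ)

/-- The numerator and denominator of a nonnegative rational number. -/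
def ratPair (q : ℚ≥0) : ℕ × ℕ := (q.num, q.den)

/-- The data of an instance together with a bound on the activation cost or on the makespan. -/
def rawInput (x : RelatedInstance × ℚ≥0) : RawInput :=
  ((List.ofFn fun j => ratPair (x.1.p j), List.ofFn fun i => (ratPair (x.1.s i), ratPair (x.1.a i))),
    ratPair x.2)

/-- The product of all denominators in an instance. -/
def commonDen (x : RawInput) : ℕ :=
  ((x.1.1.map fun q => q.2) ++ ((x.1.2.map fun M => M.1.2) ++ x.1.2.map fun M => M.2.2)).prod

/-- The product of the rational number `q` with the multiple `D` of its denominator. -/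
def scale (D : ℕ) (q : ℕ × ℕ) : ℕ := q.1 * (D / q.2)

/-- The sizes of the jobs, multiplied by the common denominator. -/
def scaledJobs (x : RawInput) : List ℕ := x.1.1.map fun q => scale (commonDen x) q

/-- The speeds and activation costs of the machines, multiplied by the common denominator. -/
def scaledMachines (x : RawInput) : List (ℕ × ℕ) :=
  x.1.2.map fun M => (scale (commonDen x) M.1, scale (commonDen x) M.2)

theorem enc_rawInput (x : RelatedInstance × ℚ≥0) :
    enc (rawInput x) = .pair x.1.encode (encodeRat x.2) := by
  simp only [rawInput, enc, RelatedInstance.encode, List.map_ofFn]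
  rfl

theorem cast_scale {D : ℕ} {q : ℚ≥0} (h : q.den ∣ D) : (scale D (ratPair q) : ℚ≥0) = D * q := by
  have hden : (q.den : ℚ≥0) ≠ 0 := by simp
  rw [scale, ratPair, Nat.cast_mul, Nat.cast_div h hden]
  conv_rhs => rw [← NNRat.num_div_den q]
  field_simp

theorem isScaled_rawInput (x : RelatedInstance × ℚ≥0) :
    IsScaled x.1 (commonDen (rawInput x)) (scaledJobs (rawInput x))
      (scaledMachines (rawInput x)) := by
  refine ⟨?_, by simp [scaledJobs, rawInput], by simp [scaledMachines, rawInput], fun j => ?_,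
    fun i => ?_, fun i => ?_⟩
  · refine List.prod_pos fun d hd => ?_
    simp only [rawInput, List.map_ofFn, List.mem_append, List.mem_ofFn', Set.mem_range,
      Function.comp_apply] at hd
    rcases hd with ⟨j, rfl⟩ | ⟨i, rfl⟩ | ⟨i, rfl⟩ <;> exact NNRat.den_pos _
  · simp only [scaledJobs, rawInput, List.getD_eq_getElem?_getD]
    simp only [List.map_ofFn, List.getElem?_ofFn, j.2, dif_pos, Option.getD_some,
      Function.comp_apply]
    refine cast_scale (List.dvd_prod ?_)
    simp [ratPair]
  · simp only [scaledMachines, rawInput, List.getD_eq_getElem?_getD]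
    simp only [List.map_ofFn, List.getElem?_ofFn, i.2, dif_pos, Option.getD_some,
      Function.comp_apply]
    refine cast_scale (List.dvd_prod ?_)
    simp [ratPair]
  · simp only [scaledMachines, rawInput, List.getD_eq_getElem?_getD]
    simp only [List.map_ofFn, List.getElem?_ofFn, i.2, dif_pos, Option.getD_some,
      Function.comp_apply]
    refine cast_scale (List.dvd_prod ?_)
    simp [ratPair]

/-! ### The algorithms -/

/-- A cheapest element of a list (and `d` if the list is empty). -/
def cheapest {σ : Type} (cost : σ → ℕ) (S : List σ) (d : σ) : σ :=
  (prune (fun _ => ([] : List ℕ)) cost S).getD 0 d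

theorem cheapest_spec {σ : Type} {cost : σ → ℕ} {S : List σ} {x : σ} (d : σ) (hx : x ∈ S) :
    cheapest cost S d ∈ S ∧ cost (cheapest cost S d) ≤ cost x := by
  obtain ⟨y, hy, -, hle⟩ := exists_mem_prune (key := fun _ => ([] : List ℕ)) (cost := cost) hx
  have hnd := nodup_map_prune (key := fun _ => ([] : List ℕ)) (cost := cost) S
  have hmem := fun z => mem_of_mem_prune (key := fun _ => ([] : List ℕ)) (cost := cost) (S := S)
    (x := z)
  unfold cheapest
  generalize prune (fun _ => ([] : List ℕ)) cost S = T at *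
  match T with
  | [] => simp at hy
  | [z] =>
    rw [List.mem_singleton.1 hy] at hle
    exact ⟨hmem z (by simp), hle⟩
  | _ :: _ :: _ => simp at hnd

/-- The algorithm for a given bound on the makespan. -/
def minCost (N : ℕ) (x : RawInput) : List ℕ × List ℕ :=
  toOutput (scaledMachines x) (cheapest
    (usedCost (sortMachines (machineList (scaledMachines x) x.2.1)))
    (assignments N (scaledJobs x) (scaledMachines x) x.2.1 x.2.2) [])

/-- The numerators of the makespans that are tried if the activation budget is given; their common
denominator is `N` times the product of the speeds. They comprise `0` and, for all `k ≤ N * n`, the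
`k / N`-fold of the time that any one of the `n` jobs takes on any machine. -/
def candidates (N : ℕ) (pl : List ℕ) (ml : List (ℕ × ℕ)) : List ℕ :=
  0 :: (indices pl).flatMap fun j => (indices ml).flatMap fun i => (indices pl).flatMap fun k =>
    (List.range N).map fun r => pl.getD j 0 * (N * k + r + 1) *
      ((ml.map fun M => M.1).prod / (ml.getD i (0, 0)).1)

/-- The assignments within the activation budget for all makespans that are tried, each together
with its makespan. -/
def affordable (N : ℕ) (x : RawInput) : List (ℕ × List ℕ) :=
  (candidates N (scaledJobs x) (scaledMachines x)).flatMap fun t =>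
    ((assignments N (scaledJobs x) (scaledMachines x) t
      (N * ((scaledMachines x).map fun M => M.1).prod)).filter fun f =>
        usedCost (sortMachines (machineList (scaledMachines x) t)) f * x.2.2 ≤
          commonDen x * x.2.1).map fun f => (t, f)

/-- The algorithm for a given activation budget. -/
def minMakespan (N : ℕ) (x : RawInput) : List ℕ × List ℕ :=
  toOutput (scaledMachines x) (cheapest (fun z => z.1) (affordable N x) (0, [])).2

namespace PolyTime

variable {α σ : Type} [Enc α] [Enc σ]

@[fun_prop]
theorem commonDen {x : α → RawInput} (hx : PolyTime x) : PolyTime fun a => commonDen (x a) := by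
  unfold MachineActivation.commonDen
  fun_prop

@[fun_prop]
theorem scale {D : α → ℕ} {q : α → ℕ × ℕ} (hD : PolyTime D) (hq : PolyTime q) :
    PolyTime fun a => scale (D a) (q a) := by
  unfold MachineActivation.scale
  fun_prop

@[fun_prop]
theorem scaledJobs {x : α → RawInput} (hx : PolyTime x) : PolyTime fun a => scaledJobs (x a) := by
  unfold MachineActivation.scaledJobs
  fun_prop

@[fun_prop]
theorem scaledMachines {x : α → RawInput} (hx : PolyTime x) :
    PolyTime fun a => scaledMachines (x a) := by
  unfold MachineActivation.scaledMachines
  fun_prop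

@[fun_prop]
theorem cheapest {cost : α → σ → ℕ} {S : α → List σ} {d : α → σ}
    (hcost : PolyTime fun x : α × σ => cost x.1 x.2) (hS : PolyTime S) (hd : PolyTime d) :
    PolyTime fun a => cheapest (cost a) (S a) (d a) := by
  have := prune (key := fun _ _ => []) (by fun_prop) hcost hS
  unfold MachineActivation.cheapest
  fun_prop

@[fun_prop]
theorem toOutput {ml : α → List (ℕ × ℕ)} {f : α → List ℕ} (hm : PolyTime ml) (hf : PolyTime f) :
    PolyTime fun a => toOutput (ml a) (f a) := by
  unfold MachineActivation.toOutput
  fun_prop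

@[fun_prop]
theorem candidates (N : ℕ) {pl : α → List ℕ} {ml : α → List (ℕ × ℕ)} (hp : PolyTime pl)
    (hm : PolyTime ml) : PolyTime fun a => candidates N (pl a) (ml a) := by
  unfold MachineActivation.candidates
  fun_prop

theorem minCost (N : ℕ) [NeZero N] : PolyTime (minCost N) := by
  unfold MachineActivation.minCost
  fun_prop

@[fun_prop]
theorem affordable (N : ℕ) [NeZero N] : PolyTime (affordable N) := by
  unfold MachineActivation.affordable
  refine flatMap (by fun_prop) (map (filter (p := fun (x : RawInput × ℕ) f =>
    MachineActivation.usedCost (MachineActivation.sortMachines (MachineActivation.machineList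
      (MachineActivation.scaledMachines x.1) x.2)) f * x.1.2.2 ≤
        MachineActivation.commonDen x.1 * x.1.2.1) ?_ ?_) ?_)
  · fun_prop
  · fun_prop
  · fun_prop

theorem minMakespan (N : ℕ) [NeZero N] : PolyTime (minMakespan N) := by
  unfold MachineActivation.minMakespan
  fun_prop

/-- A polynomial-time function of the data of an instance yields a program. -/
theorem exists_prog {F : RawInput → List ℕ × List ℕ} (hF : PolyTime F)
    {good : RelatedInstance × ℚ≥0 → Val → Prop} (h : ∀ x, good x (enc (F (rawInput x)))) :
    ∃ prog, SolvesInPolyTime prog (fun x : RelatedInstance × ℚ≥0 =>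
      Val.pair x.1.encode (encodeRat x.2)) good := by
  obtain ⟨p, P, hp⟩ := hF
  refine ⟨p, P, fun x => ?_⟩
  obtain ⟨t, h1, h2⟩ := hp (rawInput x)
  rw [enc_rawInput] at h1
  rw [sz, enc_rawInput] at h2
  exact ⟨_, t, h1, h2, h x⟩

end PolyTime

theorem minCost_spec {N : ℕ} (hN : 0 < N) (x : RelatedInstance × ℚ≥0) (σ : Schedule x.1)
    (hσ : σ.makespan ≤ x.2) : ∃ τ : Schedule x.1, τ.encode = enc (minCost N (rawInput x)) ∧
      τ.cost ≤ σ.cost ∧ τ.makespan ≤ (1 + 1 / N) * (1 + 2 / N) * x.2 := by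
  have h := isScaled_rawInput x
  have hD : (0 : ℚ≥0) < commonDen (rawInput x) := by exact_mod_cast h.pos
  have hT : (((rawInput x).2.1 : ℕ) : ℚ≥0) / ((rawInput x).2.2 : ℕ) = x.2 := NNRat.num_div_den x.2
  have hy : 0 < (rawInput x).2.2 := x.2.den_pos
  obtain ⟨f, hf, hcost⟩ := exists_mem_assignments h hN hy σ (hσ.trans_eq hT.symm)
  obtain ⟨h1, h2⟩ := cheapest_spec
    (cost := usedCost (sortMachines (machineList (scaledMachines (rawInput x)) (rawInput x).2.1)))
    [] hf
  obtain ⟨τ, hτ, hτc, hτm⟩ := exists_schedule_of_mem_assignments h hN hy h1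
  refine ⟨τ, hτ, ?_, by rwa [hT] at hτm⟩
  refine le_of_mul_le_mul_left ?_ hD
  rw [hτc]
  exact le_trans (Nat.cast_le.2 h2) hcost

theorem IsScaled.prod_pos {I : RelatedInstance} {D : ℕ} {pl : List ℕ} {ml : List (ℕ × ℕ)}
    (h : IsScaled I D pl ml) : 0 < (ml.map fun M => M.1).prod := by
  refine List.prod_pos fun s hs => ?_
  obtain ⟨M, hM, rfl⟩ := List.mem_map.1 hs
  obtain ⟨l, hl, rfl⟩ := List.getElem_of_mem hM
  have h1 := h.speed_eq ⟨l, h.length_ml ▸ hl⟩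
  rw [List.getD_eq_getElem _ _ hl] at h1
  have h2 : (0 : ℚ≥0) < (ml[l].1 : ℕ) := by
    rw [h1]
    exact mul_pos (by exact_mod_cast h.pos) (I.s_pos _)
  exact_mod_cast h2

/-- The makespan of every schedule is approximated from above by one of the makespans that are
tried: it is between once and `n` times the time of the largest job on a critical machine. -/
theorem exists_mem_candidates {I : RelatedInstance} {D N : ℕ} {pl : List ℕ} {ml : List (ℕ × ℕ)}
    (h : IsScaled I D pl ml) (hN : 0 < N) (σ : Schedule I) :
    ∃ t ∈ candidates N pl ml,
      σ.makespan ≤ (t : ℚ≥0) / (N * (ml.map fun M => M.1).prod : ℕ) ∧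
      (t : ℚ≥0) / (N * (ml.map fun M => M.1).prod : ℕ) ≤ (1 + 1 / N) * σ.makespan := by
  have hD : (0 : ℚ≥0) < D := by exact_mod_cast h.pos
  have hN' : (0 : ℚ≥0) < N := by exact_mod_cast hN
  by_cases hpos : σ.makespan = 0
  · refine ⟨0, by simp [candidates], ?_⟩
    simp [hpos]
  have hm : (Finset.univ : Finset (Fin I.m)).Nonempty := by
    rw [Finset.nonempty_iff_ne_empty]
    intro he
    exact hpos (by rw [Schedule.makespan, he, Finset.sup_empty]; rfl)
  obtain ⟨i, -, hi⟩ := Finset.exists_mem_eq_sup _ hm σ.load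
  change σ.makespan = _ at hi
  have hJ : (Finset.univ.filter fun j => σ.assign j = i).Nonempty := by
    rw [Finset.nonempty_iff_ne_empty]
    intro he
    exact hpos (by rw [hi, Schedule.load, he, Finset.sum_empty])
  obtain ⟨j, hj, hmax⟩ := Finset.exists_max_image _ I.p hJ
  have hs : 0 < I.s i := I.s_pos i
  have hp : 0 < I.p j := I.p_pos j
  -- the makespan in units of the time of job `j` on machine `i`
  set q : ℚ≥0 := σ.makespan * I.s i / I.p j with hq
  have hq0 : 0 < q := by
    have := pos_iff_ne_zero.2 hpos
    positivity
  have hq1 : 1 ≤ q := by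
    rw [hq, hi, Schedule.load, le_div_iff₀ hp, one_mul, ← div_le_iff₀ hs]
    exact Finset.single_le_sum (f := fun j => I.p j / I.s i) (fun _ _ => zero_le) hj
  have hqn : q ≤ I.n := by
    rw [hq, hi, Schedule.load, div_le_iff₀ hp, Finset.sum_mul]
    calc _ ≤ ∑ j' with σ.assign j' = i, I.p j := Finset.sum_le_sum fun j' hj' => by
          rw [div_mul_cancel₀ _ hs.ne']
          exact hmax j' hj'
      _ ≤ ∑ j' : Fin I.n, I.p j := Finset.sum_le_sum_of_subset (Finset.subset_univ _)
      _ = _ := by simp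
  -- the makespan `(k + 1) / N` times that unit, with the least `k` for which it suffices
  obtain ⟨k, hk⟩ : ∃ k, ⌈q * N⌉₊ = k + 1 :=
    ⟨⌈q * N⌉₊ - 1, by have := Nat.ceil_pos.2 (mul_pos hq0 hN'); omega⟩
  have hkn : k < N * I.n := by
    have : ⌈q * N⌉₊ ≤ N * I.n := by
      rw [Nat.ceil_le]
      push_cast
      rw [mul_comm]
      exact mul_le_mul_of_nonneg_left hqn hN'.le
    omega
  have hk1 : q * N ≤ (k + 1 : ℕ) := hk ▸ Nat.le_ceil _
  have hk2 : ((k + 1 : ℕ) : ℚ≥0) ≤ q * N + 1 := by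
    rw [← hk]
    exact (Nat.ceil_lt_add_one (by positivity)).le
  have hSpos := h.prod_pos
  have hil : (i : ℕ) < ml.length := i.2.trans_eq h.length_ml.symm
  have hdvd : (ml.getD i (0, 0)).1 ∣ (ml.map fun M => M.1).prod := by
    refine List.dvd_prod (List.mem_map_of_mem ?_)
    rw [List.getD_eq_getElem _ _ hil]
    exact List.getElem_mem _
  have hval : ((pl.getD j 0 * (k + 1) * ((ml.map fun M => M.1).prod / (ml.getD i (0, 0)).1) : ℕ) :
      ℚ≥0) / (N * (ml.map fun M => M.1).prod : ℕ) = I.p j / I.s i * ((k + 1 : ℕ) / N) := by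
    have hs' : (((ml.getD i (0, 0)).1 : ℕ) : ℚ≥0) ≠ 0 := by
      rw [h.speed_eq]
      positivity
    have hS' : (((ml.map fun M => M.1).prod : ℕ) : ℚ≥0) ≠ 0 := by exact_mod_cast hSpos.ne'
    rw [Nat.cast_mul, Nat.cast_div hdvd hs', Nat.cast_mul, Nat.cast_mul, h.size_eq, h.speed_eq]
    field_simp
  have hmk : σ.makespan = I.p j / I.s i * q := by
    rw [hq]
    field_simp
  refine ⟨pl.getD j 0 * (k + 1) * ((ml.map fun M => M.1).prod / (ml.getD i (0, 0)).1), ?_,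
    hval.symm ▸ ?_, hval.symm ▸ ?_⟩
  · refine List.mem_cons_of_mem _ (List.mem_flatMap.2 ⟨j, ?_, List.mem_flatMap.2 ⟨i, ?_,
      List.mem_flatMap.2 ⟨k / N, ?_, List.mem_map.2 ⟨k % N, ?_, ?_⟩⟩⟩⟩)
    · rw [mem_indices, h.length_pl]
      exact j.2
    · rw [mem_indices]
      exact hil
    · rw [mem_indices, h.length_pl]
      exact Nat.div_lt_of_lt_mul hkn
    · exact List.mem_range.2 (Nat.mod_lt _ hN)
    · rw [Nat.div_add_mod]
  · rw [hmk]
    refine mul_le_mul_of_nonneg_left ?_ (by positivity)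
    rwa [le_div_iff₀ hN']
  · have h1 : ((k + 1 : ℕ) : ℚ≥0) / N ≤ (1 + 1 / N) * q := by
      rw [div_le_iff₀ hN']
      calc _ ≤ q * N + q := hk2.trans (by gcongr)
        _ = _ := by field_simp
    calc _ ≤ I.p j / I.s i * ((1 + 1 / N) * q) := mul_le_mul_of_nonneg_left h1 (by positivity)
      _ = _ := by rw [hmk]; ring

theorem minMakespan_spec {N : ℕ} (hN : 0 < N) (x : RelatedInstance × ℚ≥0) (σ : Schedule x.1)
    (hσ : σ.cost ≤ x.2) : ∃ τ : Schedule x.1, τ.encode = enc (minMakespan N (rawInput x)) ∧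
      τ.cost ≤ x.2 ∧ τ.makespan ≤ (1 + 1 / N) * (1 + 2 / N) * ((1 + 1 / N) * σ.makespan) := by
  have h := isScaled_rawInput x
  have hD : (0 : ℚ≥0) < commonDen (rawInput x) := by exact_mod_cast h.pos
  have hA : (((rawInput x).2.1 : ℕ) : ℚ≥0) = x.2 * ((rawInput x).2.2 : ℕ) :=
    (NNRat.mul_den_eq_num x.2).symm
  have hA' : (0 : ℚ≥0) < ((rawInput x).2.2 : ℕ) := by exact_mod_cast x.2.den_pos
  have hy : 0 < N * ((scaledMachines (rawInput x)).map fun M => M.1).prod :=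
    Nat.mul_pos hN h.prod_pos
  have hbudget : ∀ (t : ℕ) (f : List ℕ),
      usedCost (sortMachines (machineList (scaledMachines (rawInput x)) t)) f * (rawInput x).2.2 ≤
        commonDen (rawInput x) * (rawInput x).2.1 ↔
      (usedCost (sortMachines (machineList (scaledMachines (rawInput x)) t)) f : ℚ≥0) ≤
        commonDen (rawInput x) * x.2 := fun t f => by
    rw [← Nat.cast_le (α := ℚ≥0), Nat.cast_mul, Nat.cast_mul, hA, ← mul_assoc,
      mul_le_mul_iff_left₀ hA']
  obtain ⟨t, ht, ht1, ht2⟩ := exists_mem_candidates h hN σ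
  obtain ⟨f, hf, hcost⟩ := exists_mem_assignments h hN hy σ ht1
  have hmem : (t, f) ∈ affordable N (rawInput x) := by
    refine List.mem_flatMap.2 ⟨t, ht, List.mem_map.2 ⟨f, List.mem_filter.2 ⟨hf, ?_⟩, rfl⟩⟩
    rw [decide_eq_true_eq, hbudget]
    exact hcost.trans (mul_le_mul_of_nonneg_left hσ hD.le)
  obtain ⟨h1, h2⟩ := cheapest_spec (cost := fun z : ℕ × List ℕ => z.1) (0, []) hmem
  obtain ⟨t', -, h3⟩ := List.mem_flatMap.1 h1
  obtain ⟨f', h4, h5⟩ := List.mem_map.1 h3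
  obtain ⟨h6, h7⟩ := List.mem_filter.1 h4
  rw [decide_eq_true_eq, hbudget] at h7
  rw [← h5] at h2
  obtain ⟨τ, hτ, hτc, hτm⟩ := exists_schedule_of_mem_assignments h hN hy h6
  refine ⟨τ, ?_, le_of_mul_le_mul_left (hτc.trans_le h7) hD, hτm.trans ?_⟩
  · rw [hτ, minMakespan, ← h5]
  · refine mul_le_mul_of_nonneg_left (le_trans ?_ ht2) (by positivity)
    have : (t' : ℚ≥0) ≤ t := Nat.cast_le.2 h2
    gcongr

/-- A choice of `N` for which all errors together stay below the factor `1 + ε`. -/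
theorem exists_precision {ε : ℝ} (hε : 0 < ε) : ∃ N : ℕ, 0 < N ∧
    (1 + 1 / (N : ℝ)) * (1 + 2 / N) * (1 + 1 / N) ≤ 1 + ε := by
  obtain ⟨N, hN⟩ := exists_nat_gt (max 1 (11 / ε))
  have h1 : (1 : ℝ) < N := (le_max_left _ _).trans_lt hN
  have h2 : 11 / ε < N := (le_max_right _ _).trans_lt hN
  -- for `u = 1 / N ≤ 1` the product is at most `1 + 11 * u`
  refine ⟨N, by exact_mod_cast zero_lt_one.trans h1, ?_⟩
  rw [div_lt_iff₀ hε] at h2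
  have h3 : 0 < 1 / (N : ℝ) := by positivity
  have h4 : 1 / (N : ℝ) ≤ 1 := by rw [div_le_one (by linarith)]; exact h1.le
  have h5 : 11 * (1 / (N : ℝ)) ≤ ε := by
    rw [mul_one_div, div_le_iff₀ (by linarith)]
    linarith
  have h6 : 2 / (N : ℝ) = 2 * (1 / N) := by ring
  rw [h6]
  generalize 1 / (N : ℝ) = u at *
  nlinarith [mul_nonneg h3.le (sub_nonneg.2 h4), mul_nonneg (mul_nonneg h3.le h3.le)
    (sub_nonneg.2 h4)]

end MachineActivation

theorem mainTheorem4 (ε : ℝ) (hε : 0 < ε) :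
    -- the activation budget `A` is given, and the makespan is minimized up to the factor `1 + ε`
    (∃ prog : MachineActivation.Prog,
      MachineActivation.SolvesInPolyTime prog
        (fun x : MachineActivation.RelatedInstance × ℚ≥0 =>
          MachineActivation.Val.pair x.1.encode (MachineActivation.encodeRat x.2))
        (fun x y => ∀ T : ℝ,
          (∃ σ : MachineActivation.Schedule x.1, σ.cost ≤ x.2 ∧ (σ.makespan : ℝ) ≤ T) →
          ∃ τ : MachineActivation.Schedule x.1, y = τ.encode ∧
            τ.cost ≤ x.2 ∧ (τ.makespan : ℝ) ≤ (1 + ε) * T)) ∧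
    -- the makespan bound `T` is given, and the activation cost is minimized
    (∃ prog : MachineActivation.Prog,
      MachineActivation.SolvesInPolyTime prog
        (fun x : MachineActivation.RelatedInstance × ℚ≥0 =>
          MachineActivation.Val.pair x.1.encode (MachineActivation.encodeRat x.2))
        (fun x y => ∀ A : ℝ,
          (∃ σ : MachineActivation.Schedule x.1, (σ.cost : ℝ) ≤ A ∧ σ.makespan ≤ x.2) →
          ∃ τ : MachineActivation.Schedule x.1, y = τ.encode ∧
            (τ.cost : ℝ) ≤ A ∧ (τ.makespan : ℝ) ≤ (1 + ε) * (x.2 : ℝ))) := by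
  obtain ⟨N, hN, hNε⟩ := MachineActivation.exists_precision hε
  have : NeZero N := ⟨hN.ne'⟩
  refine ⟨MachineActivation.PolyTime.exists_prog (.minMakespan N) fun x T hσ => ?_,
    MachineActivation.PolyTime.exists_prog (.minCost N) fun x A hσ => ?_⟩
  · obtain ⟨σ, hσ, hT⟩ := hσ
    obtain ⟨τ, h1, h2, h3⟩ := MachineActivation.minMakespan_spec hN x σ hσ
    refine ⟨τ, h1.symm, h2, ?_⟩
    have h4 := (NNRat.cast_le (K := ℝ)).2 h3
    push_cast at h4
    have h5 : (0 : ℝ) ≤ σ.makespan := by positivity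
    calc (τ.makespan : ℝ) ≤ (1 + 1 / N) * (1 + 2 / N) * (1 + 1 / N) * σ.makespan := by
          rwa [mul_assoc]
      _ ≤ (1 + ε) * σ.makespan := mul_le_mul_of_nonneg_right hNε h5
      _ ≤ (1 + ε) * T := mul_le_mul_of_nonneg_left hT (by positivity)
  · obtain ⟨σ, hA, hσ⟩ := hσ
    obtain ⟨τ, h1, h2, h3⟩ := MachineActivation.minCost_spec hN x σ hσ
    refine ⟨τ, h1.symm, le_trans (by exact_mod_cast h2) hA, ?_⟩
    have h4 := (NNRat.cast_le (K := ℝ)).2 h3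
    push_cast at h4
    have h5 : (0 : ℝ) ≤ x.2 := by positivity
    refine h4.trans (mul_le_mul_of_nonneg_right (le_trans ?_ hNε) h5)
    have h6 : (0 : ℝ) ≤ (1 + 1 / N) * (1 + 2 / N) := by positivity
    have h7 : (0 : ℝ) ≤ 1 / N := by positivity
    nlinarith
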